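/- **Setting.** Let $d\ge 1$ and let $\Omega\subset\mathbb R^d$ be a bounded open set with $\Omega=\operatorname{int}\overline\Omega$ (for instance a bounded Lipschitz domain), with a conforming triangulation $\mathcal T$: a finite set of nondegenerate $d$-simplices $K$ with $\bigcup_K\overline K=\overline\Omega$, such that any two closed elements $\overline K,\overline J$ meet exactly in the (possibly empty) subsimplex spanned by their common vertices. Let $h(x)=\max_{\overline K\ni x}\operatorname{diam}K$, let $\mathcal E$ be the set of faces shared by two elements, and identify $\partial\Omega$ with the set of faces lying on $\partial\Omega$. Fix a degree $p\ge 0$ and let $$V=\{u: u|_K \text{ is a polynomial of degree}\le p \ \forall K\in\mathcal T\},\quad V_0=\{u\in V: u=0\text{ on }\partial\Omega\},\quad V_n=\{\mathbf q\in V^d:\mathbf q\cdot\mathbf n=0\text{ on }\partial\Omega\},$$ where boundary values are traces on boundary faces. All derivatives below are taken elementwise and $\int_\Omega=\sum_K\int_K$. On a face of $\mathcal E$ shared by $K_1,K_2$ with outward unit normals $\mathbf n_1,\mathbf n_2$ put $\{u\}=\frac12(u|_{K_1}+u|_{K_2})$ (for scalar, vector and matrix valued $u$), $[u]=u|_{K_1}\mathbf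 n_1+u|_{K_2}\mathbf n_2$ for scalar $u$, and $[\mathbf u]=\mathbf u|_{K_1}\cdot\mathbf n_1+\mathbf u|_{K_2}\cdot\mathbf n_2$, $[\mathbf u]_\otimes=\mathbf u|_{K_1}\otimes\mathbf n_1+\mathbf u|_{K_2}\otimes\mathbf n_2$ for vector $\mathbf u$; on $\partial\Omega$ put $\{u\}=u$, $[u]=u\mathbf n$, $[\mathbf u]=\mathbf u\cdot\mathbf n$, $[\mathbf u]_\otimes=\mathbf u\otimes\mathbf n$. Let $\rho_1,\rho_2,\gamma,\eta,m_j,m_r>0$, $\sigma\in\mathbb R$, $W\in C^1(\mathbb R)$, $c_\pm=\frac1{\rho_1}\pm\frac1{\rho_2}$, $\rho(\phi)=\frac12[\rho_1(1+\phi)+\rho_2(1-\phi)]$, and define the interior penalty forms $$A_1(a,\chi)=-\int_\Omega\nabla a\cdot\nabla\chi+\int_{\mathcal E}\Big(\{\nabla\chi\}\cdot[a]+[\chi]\cdot\{\nabla a\}-\frac{\sigma}{h}[a]\cdot[\chi]\Big),$$ $$A_2(\mathbf v,\boldsymbol\xi)=-\int_\Omega D\mathbf v:D\boldsymbol\xi+\int_{\mathcal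 E\cup\partial\Omega}\Big(\{D\boldsymbol\xi\}:[\mathbf v]_\otimes+\{D\mathbf v\}:[\boldsymbol\xi]_\otimes-\frac{\sigma}{h}[\mathbf v]_\otimes:[\boldsymbol\xi]_\otimes\Big).$$ **Scheme.** Let $t_0<t_1<\dots<t_N$ and $k_n=t_{n+1}-t_n$, and for a sequence $F^n$ let $F^{n+1/2}=\frac12(F^n+F^{n+1})$. Let $(\phi^n,\mathbf v^n,\lambda^n,a^n,b^n,\mathbf q^n)\in V\times V_0^d\times V\times V\times V\times V_n$, $0\le n\le N$ (the subscript $h$ is omitted), satisfy for every $0\le n<N$ and all $(\chi,\boldsymbol\xi,\zeta,\psi,\upsilon,\boldsymbol\tau)\in V\times V_0^d\times V\times V\times V\times V_n$ the equations below, in which $\phi,\mathbf v,\lambda,a,b,\mathbf q$ without a superscript denote the values at level $n+\frac12$: $$0=\int_\Omega\Big(\tfrac{\phi^{n+1}-\phi^n}{k_n}+\operatorname{div}(\phi\mathbf v)+c_+m_ra\Big)\chi-c_+m_jA_1(a,\chi)-\int_{\mathcal E}[\phi\mathbf v]\{\chi\},$$ $$\begin{aligned}0=&\int_\Omega\Big(\rho(\phi)\tfrac{\mathbf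 v^{n+1}-\mathbf v^n}{k_n}+\rho(\phi)(\mathbf v\cdot\nabla)\mathbf v-\tfrac12\rho(\phi)\nabla|\mathbf v|^2+\nabla b+\tfrac{\phi}{c_+}\nabla(a-c_-b)\Big)\cdot\boldsymbol\xi-\eta A_2(\mathbf v,\boldsymbol\xi)\\&+\int_{\mathcal E}\Big(-\big(\{\boldsymbol\xi\}\otimes\{\rho(\phi)\mathbf v\}\big):[\mathbf v]_\otimes+\tfrac12[|\mathbf v|^2]\cdot\{\rho(\phi)\boldsymbol\xi\}-[b]\cdot\{\boldsymbol\xi\}-\tfrac1{c_+}[a-c_-b]\cdot\{\phi\boldsymbol\xi\}\Big),\end{aligned}$$ $$0=\int_\Omega\Big(\operatorname{div}\mathbf v-\tfrac{c_-}{c_+}\tfrac{\phi^{n+1}-\phi^n}{k_n}-\tfrac{c_-}{c_+}\operatorname{div}(\phi\mathbf v)\Big)\zeta+\int_{\mathcal E}\big[\tfrac{c_-}{c_+}\phi\mathbf v-\mathbf v\big]\{\zeta\},$$ $$0=\int_\Omega\Big(a-c_+\tfrac{W(\phi^{n+1})-W(\phi^n)}{\phi^{n+1}-\phi^n}-c_-\lambda+c_+\gamma\operatorname{div}\mathbf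 q\Big)\psi-c_+\gamma\int_{\mathcal E}[\mathbf q]\{\psi\},$$ $$0=\int_\Omega\Big(b-\lambda-\tfrac{\rho_1+\rho_2}{8}\big(|\mathbf v^{n+1}|^2+|\mathbf v^n|^2\big)\Big)\upsilon,$$ $$0=\int_\Omega(\mathbf q-\nabla\phi)\cdot\boldsymbol\tau+\int_{\mathcal E}[\phi]\cdot\{\boldsymbol\tau\}.$$ The difference quotient of $W$ is read as $W'(\phi^n)$ where $\phi^{n+1}=\phi^n$. The initial data are assumed compatible: $\mathbf q^0$ is the discrete gradient of $\phi^0$, that is, the last equation also holds with $(\phi^0,\mathbf q^0)$ in place of $(\phi,\mathbf q)$, for all $\boldsymbol\tau\in V_n$. **Theorem.** For every $0\le n<N$, $$\begin{aligned}\int_\Omega W(\phi^{n+1})&+\tfrac12\rho(\phi^{n+1})|\mathbf v^{n+1}|^2+\tfrac\gamma2|\mathbf q^{n+1}|^2=\int_\Omega W(\phi^{n})+\tfrac12\rho(\phi^{n})|\mathbf v^{n}|^2+\tfrac\gamma2|\mathbf q^{n}|^2\\&-k_n\Big(\int_\Omega m_r\big(a^{n+1/2}\big)^2-m_jA_1\big(a^{n+1/2},a^{n+1/2}\big)-\eta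 A_2\big(\mathbf v^{n+1/2},\mathbf v^{n+1/2}\big)\Big).\end{aligned}$$ -/

import Mathlib

open MeasureTheory
open scoped RealInnerProductSpace

namespace DGScheme

/-! ### Triangulations -/

/-- The Euclidean space `ℝ^d`. -/
abbrev E (d : ℕ) := EuclideanSpace ℝ (Fin d)

/-- A conforming triangulation of `Ω ⊆ ℝ^d`. An element is given by the set of its `d + 1` vertices;
the closed element is the convex hull of the vertices. -/
structure Triangulation (d : ℕ) (Ω : Set (E d)) where
  /-- the elements -/
  cells : Finset (Finset (E d))
  card_cell : ∀ K ∈ cells, K.card = d + 1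
  affineIndependent_cell : ∀ K ∈ cells, AffineIndependent ℝ ((↑) : K → E d)
  /-- two closed elements meet in the subsimplex spanned by their common vertices -/
  conforming : ∀ K ∈ cells, ∀ J ∈ cells,
    convexHull ℝ (K : Set (E d)) ∩ convexHull ℝ (J : Set (E d)) =
      convexHull ℝ ((K : Set (E d)) ∩ (J : Set (E d)))
  /-- the closed elements cover the closure of `Ω` -/
  covers : ⋃ K ∈ cells, convexHull ℝ (K : Set (E d)) = closure Ω

/-- Elementwise defined ("broken") `M`-valued functions: `u K` is the function on the element `K`.
The values of `u K` on the boundary of `K` are the trace of `u` from inside `K`. Only the values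
`u K x` with `K` an element and `x` in the closed element `K` are ever used. -/
abbrev Broken (d : ℕ) (M : Type) := Finset (E d) → E d → M

/-- Outward unit normal to the simplex `K` on its face `F`: the normalised component orthogonal to
`F` of the vector from the barycentre of `K` to the barycentre of `F`. -/
noncomputable def outwardNormal {d : ℕ} (K F : Finset (E d)) : E d :=
  NormedSpace.normalize
    ((vectorSpan ℝ (F : Set (E d)))ᗮ.starProjection
      (F.centroid ℝ id - K.centroid ℝ id))

/-- The tensor product `x ⊗ y = x yᵀ` of two vectors. -/
noncomputable def outer {d : ℕ} (x y : E d) : Matrix (Fin d) (Fin d) ℝ :=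
  Matrix.of fun i j => x i * y j

/-- The Frobenius inner product `A : B`. -/
noncomputable def frob {d : ℕ} (A B : Matrix (Fin d) (Fin d) ℝ) : ℝ :=
  ∑ i, ∑ j, A i j * B i j

/-! ### Elementwise differential operators -/

/-- Elementwise gradient. -/
noncomputable def grad {d : ℕ} (u : Broken d ℝ) : Broken d (E d) :=
  fun K x => gradient (u K) x

/-- Elementwise Jacobian, `(D v)_{ij} = ∂_j v_i`. -/
noncomputable def jac {d : ℕ} (v : Broken d (E d)) : Broken d (Matrix (Fin d) (Fin d) ℝ) :=
  fun K x => Matrix.of fun i j => fderiv ℝ (v K) x (EuclideanSpace.single j 1) i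

/-- Elementwise divergence. -/
noncomputable def dvg {d : ℕ} (v : Broken d (E d)) : Broken d ℝ :=
  fun K x => ∑ i, fderiv ℝ (v K) x (EuclideanSpace.single i 1) i

/-- Elementwise `(v · ∇) v`. -/
noncomputable def convect {d : ℕ} (v : Broken d (E d)) : Broken d (E d) :=
  fun K x => fderiv ℝ (v K) x (v K x)

namespace Triangulation

variable {d : ℕ} {Ω : Set (E d)}

/-! ### Faces, jumps, averages, integrals -/

open Classical in
/-- All `(d-1)`-dimensional faces of the elements, given by their `d` vertices. -/
noncomputable def faces (T : Triangulation d Ω) : Finset (Finset (E d)) :=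
  T.cells.biUnion fun K => K.powersetCard d

open Classical in
/-- The elements that have `F` as a face. -/
noncomputable def cellsAt (T : Triangulation d Ω) (F : Finset (E d)) : Finset (Finset (E d)) :=
  T.cells.filter fun K => F ⊆ K

open Classical in
/-- The interior skeleton `ℰ`: the faces common to two elements. -/
noncomputable def interiorFaces (T : Triangulation d Ω) : Finset (Finset (E d)) :=
  T.faces.filter fun F => (T.cellsAt F).card = 2

open Classical in
/-- The faces that lie on `∂Ω`. -/
noncomputable def boundaryFaces (T : Triangulation d Ω) : Finset (Finset (E d)) :=
  T.faces.filter fun F => convexHull ℝ (F : Set (E d)) ⊆ frontier Ω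

open Classical in
/-- `ℰ ∪ ∂Ω`. -/
noncomputable def allFaces (T : Triangulation d Ω) : Finset (Finset (E d)) :=
  T.interiorFaces ∪ T.boundaryFaces

/-- The average `{u}` at a point `x` of the face `F`: `(u|_{K₁} + u|_{K₂}) / 2` on an interior face,
`u` on a boundary face. -/
noncomputable def avg {M : Type} [AddCommGroup M] [Module ℝ M] (T : Triangulation d Ω)
    (u : Broken d M) (F : Finset (E d)) (x : E d) : M :=
  ((T.cellsAt F).card : ℝ)⁻¹ • ∑ K ∈ T.cellsAt F, u K x

/-- The (vector valued) jump of a scalar function: `u|_{K₁} n_{K₁} + u|_{K₂} n_{K₂}` on an interior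
face, `u n` on a boundary face. -/
noncomputable def jump (T : Triangulation d Ω)
    (u : Broken d ℝ) (F : Finset (E d)) (x : E d) : E d :=
  ∑ K ∈ T.cellsAt F, u K x • outwardNormal K F

/-- The (scalar) jump of a vector valued function. -/
noncomputable def vjump (T : Triangulation d Ω)
    (u : Broken d (E d)) (F : Finset (E d)) (x : E d) : ℝ :=
  ∑ K ∈ T.cellsAt F, ⟪u K x, outwardNormal K F⟫

/-- The tensor jump of a vector valued function. -/
noncomputable def tjump (T : Triangulation d Ω)
    (u : Broken d (E d)) (F : Finset (E d)) (x : E d) : Matrix (Fin d) (Fin d) ℝ :=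
  ∑ K ∈ T.cellsAt F, outer (u K x) (outwardNormal K F)

/-- The integral over `Ω` of an elementwise defined function. -/
noncomputable def integral (T : Triangulation d Ω) (u : Broken d ℝ) : ℝ :=
  ∑ K ∈ T.cells, ∫ x in convexHull ℝ (K : Set (E d)), u K x

/-- The surface integral, over a collection `S` of faces, of a function defined facewise
(with respect to the `(d-1)`-dimensional surface measure). -/
noncomputable def faceIntegral (S : Finset (Finset (E d))) (g : Finset (E d) → E d → ℝ) : ℝ :=
  ∑ F ∈ S, ∫ x in convexHull ℝ (F : Set (E d)), g F x ∂μHE[d - 1]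

/-- The mesh size function: the maximal diameter of the closed elements that contain `x`. -/
noncomputable def meshSize (T : Triangulation d Ω) (x : E d) : ℝ :=
  sSup {r | ∃ K ∈ T.cells, x ∈ convexHull ℝ (K : Set (E d)) ∧
    r = Metric.diam (convexHull ℝ (K : Set (E d)))}

/-! ### Finite element spaces -/

/-- `u ∈ V`: on each element `u` is a polynomial of degree at most `p`. -/
def MemV (T : Triangulation d Ω) (p : ℕ) (u : Broken d ℝ) : Prop :=
  ∀ K ∈ T.cells, ∃ P : MvPolynomial (Fin d) ℝ,
    P.totalDegree ≤ p ∧ ∀ x : E d, u K x = MvPolynomial.eval (fun i => x i) P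

/-- `u ∈ V₀`: `u ∈ V` has zero trace on `∂Ω`. -/
def MemV0 (T : Triangulation d Ω) (p : ℕ) (u : Broken d ℝ) : Prop :=
  T.MemV p u ∧ ∀ F ∈ T.boundaryFaces, ∀ K ∈ T.cellsAt F,
    ∀ x ∈ convexHull ℝ (F : Set (E d)), u K x = 0

/-- `v ∈ V₀^d`. -/
def MemV0d (T : Triangulation d Ω) (p : ℕ) (v : Broken d (E d)) : Prop :=
  ∀ i, T.MemV0 p fun K x => v K x i

/-- `q ∈ V_n`: `q ∈ V^d` has zero normal trace on `∂Ω`. -/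
def MemVn (T : Triangulation d Ω) (p : ℕ) (q : Broken d (E d)) : Prop :=
  (∀ i, T.MemV p fun K x => q K x i) ∧
  ∀ F ∈ T.boundaryFaces, ∀ K ∈ T.cellsAt F,
    ∀ x ∈ convexHull ℝ (F : Set (E d)), ⟪q K x, outwardNormal K F⟫ = 0

/-! ### Interior penalty forms -/

/-- The interior penalty discretisation of the scalar Laplacian with penalty parameter `σ`. -/
noncomputable def A₁ (T : Triangulation d Ω) (σ : ℝ) (a χ : Broken d ℝ) : ℝ :=
  - T.integral (fun K x => ⟪grad a K x, grad χ K x⟫)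
  + faceIntegral T.interiorFaces (fun F x =>
      ⟪T.avg (grad χ) F x, T.jump a F x⟫
      + ⟪T.jump χ F x, T.avg (grad a) F x⟫
      - σ / T.meshSize x * ⟪T.jump a F x, T.jump χ F x⟫)

/-- The interior penalty discretisation of the vector Laplacian with penalty parameter `σ`. -/
noncomputable def A₂ (T : Triangulation d Ω) (σ : ℝ) (v ξ : Broken d (E d)) : ℝ :=
  - T.integral (fun K x => frob (jac v K x) (jac ξ K x))
  + faceIntegral T.allFaces (fun F x =>
      frob (T.avg (jac ξ) F x) (T.tjump v F x)
      + frob (T.avg (jac v) F x) (T.tjump ξ F x)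
      - σ / T.meshSize x * frob (T.tjump v F x) (T.tjump ξ F x))

end Triangulation

/-! ### The model and the fully discrete scheme -/

/-- The data of the model. -/
structure Model where
  /-- density of the first constituent -/
  ρ₁ : ℝ
  /-- density of the second constituent -/
  ρ₂ : ℝ
  /-- capillarity -/
  γ : ℝ
  /-- viscosity -/
  η : ℝ
  /-- mobility -/
  mj : ℝ
  /-- mobility -/
  mr : ℝ
  /-- penalty parameter -/
  σ : ℝ
  /-- potential -/
  W : ℝ → ℝ
  ρ₁_pos : 0 < ρ₁
  ρ₂_pos : 0 < ρ₂
  γ_pos : 0 < γ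
  η_pos : 0 < η
  mj_pos : 0 < mj
  mr_pos : 0 < mr
  contDiff_W : ContDiff ℝ 1 W

namespace Model

/-- `c₊ = 1/ρ₁ + 1/ρ₂` -/
noncomputable def cp (m : Model) : ℝ := 1 / m.ρ₁ + 1 / m.ρ₂

/-- `c₋ = 1/ρ₁ - 1/ρ₂` -/
noncomputable def cm (m : Model) : ℝ := 1 / m.ρ₁ - 1 / m.ρ₂

/-- The total density `ρ(φ)`. -/
noncomputable def ρ (m : Model) (s : ℝ) : ℝ := 1 / 2 * (m.ρ₁ * (1 + s) + m.ρ₂ * (1 - s))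

end Model

/-- The six discrete unknowns at one time level. -/
structure DGState (d : ℕ) where
  φ : Broken d ℝ
  v : Broken d (E d)
  lam : Broken d ℝ
  a : Broken d ℝ
  b : Broken d ℝ
  q : Broken d (E d)

namespace DGState

variable {d : ℕ} {Ω : Set (E d)}

/-- The unknowns lie in the finite element spaces `V, V₀^d, V, V, V, V_n`. -/
structure InSpace (S : DGState d) (T : Triangulation d Ω) (p : ℕ) : Prop where
  φ : T.MemV p S.φ
  v : T.MemV0d p S.v
  lam : T.MemV p S.lam
  a : T.MemV p S.a
  b : T.MemV p S.b
  q : T.MemVn p S.q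

/-- The mean value `F^{n+1/2} = (F^n + F^{n+1}) / 2` of all unknowns. -/
noncomputable def mid (S S' : DGState d) : DGState d where
  φ := fun K x => (1 / 2 : ℝ) * (S.φ K x + S'.φ K x)
  v := fun K x => (1 / 2 : ℝ) • (S.v K x + S'.v K x)
  lam := fun K x => (1 / 2 : ℝ) * (S.lam K x + S'.lam K x)
  a := fun K x => (1 / 2 : ℝ) * (S.a K x + S'.a K x)
  b := fun K x => (1 / 2 : ℝ) * (S.b K x + S'.b K x)
  q := fun K x => (1 / 2 : ℝ) • (S.q K x + S'.q K x)

/-- `q` is the discrete gradient of `φ` in `V_n`. -/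
def IsDiscreteGradient (T : Triangulation d Ω) (p : ℕ) (φ : Broken d ℝ) (q : Broken d (E d)) :
    Prop :=
  ∀ τ : Broken d (E d), T.MemVn p τ →
    0 = T.integral (fun K x => ⟪q K x, τ K x⟫ - ⟪grad φ K x, τ K x⟫)
      + Triangulation.faceIntegral T.interiorFaces (fun F x => ⟪T.jump φ F x, T.avg τ F x⟫)

/-- One step, of length `k`, of the fully discrete scheme, from the time level `S` to the next time
level `S'`. The difference quotient `(W(φ') - W(φ)) / (φ' - φ)` is `dslope m.W φ φ'`; it is read as
`W'(φ)` at the points where `φ' = φ`. -/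
structure Step (T : Triangulation d Ω) (m : Model) (p : ℕ) (k : ℝ) (S S' : DGState d) : Prop where
  phase : ∀ χ : Broken d ℝ, T.MemV p χ →
    0 = T.integral (fun K x =>
          ((S'.φ K x - S.φ K x) / k
            + dvg (fun K x => (mid S S').φ K x • (mid S S').v K x) K x
            + m.cp * m.mr * (mid S S').a K x) * χ K x)
        - m.cp * m.mj * T.A₁ m.σ (mid S S').a χ
        - Triangulation.faceIntegral T.interiorFaces (fun F x =>
            T.vjump (fun K x => (mid S S').φ K x • (mid S S').v K x) F x * T.avg χ F x)
  momentum : ∀ ξ : Broken d (E d), T.MemV0d p ξ →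
    0 = T.integral (fun K x =>
          m.ρ ((mid S S').φ K x) * ⟪k⁻¹ • (S'.v K x - S.v K x), ξ K x⟫
          + m.ρ ((mid S S').φ K x) * ⟪convect (mid S S').v K x, ξ K x⟫
          - 1 / 2 * m.ρ ((mid S S').φ K x)
              * ⟪grad (fun K x => ‖(mid S S').v K x‖ ^ 2) K x, ξ K x⟫
          + ⟪grad (mid S S').b K x, ξ K x⟫
          + (mid S S').φ K x / m.cp
              * ⟪grad (fun K x => (mid S S').a K x - m.cm * (mid S S').b K x) K x, ξ K x⟫)
        - m.η * T.A₂ m.σ (mid S S').v ξ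
        + Triangulation.faceIntegral T.interiorFaces (fun F x =>
            - frob (outer (T.avg ξ F x)
                  (T.avg (fun K x => m.ρ ((mid S S').φ K x) • (mid S S').v K x) F x))
                (T.tjump (mid S S').v F x)
            + 1 / 2 * ⟪T.jump (fun K x => ‖(mid S S').v K x‖ ^ 2) F x,
                T.avg (fun K x => m.ρ ((mid S S').φ K x) • ξ K x) F x⟫
            - ⟪T.jump (mid S S').b F x, T.avg ξ F x⟫
            - 1 / m.cp * ⟪T.jump (fun K x => (mid S S').a K x - m.cm * (mid S S').b K x) F x,
                T.avg (fun K x => (mid S S').φ K x • ξ K x) F x⟫)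
  constraint : ∀ ζ : Broken d ℝ, T.MemV p ζ →
    0 = T.integral (fun K x =>
          dvg (mid S S').v K x * ζ K x
          - m.cm / m.cp * ((S'.φ K x - S.φ K x) / k) * ζ K x
          - m.cm / m.cp * dvg (fun K x => (mid S S').φ K x • (mid S S').v K x) K x * ζ K x)
        + Triangulation.faceIntegral T.interiorFaces (fun F x =>
            T.vjump (fun K x =>
              (m.cm / m.cp * (mid S S').φ K x) • (mid S S').v K x - (mid S S').v K x) F x
            * T.avg ζ F x)
  potential : ∀ ψ : Broken d ℝ, T.MemV p ψ →
    0 = T.integral (fun K x =>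
          ((mid S S').a K x - m.cp * dslope m.W (S.φ K x) (S'.φ K x)
            - m.cm * (mid S S').lam K x) * ψ K x
          + m.cp * m.γ * dvg (mid S S').q K x * ψ K x)
        - m.cp * m.γ * Triangulation.faceIntegral T.interiorFaces (fun F x =>
            T.vjump (mid S S').q F x * T.avg ψ F x)
  multiplier : ∀ υ : Broken d ℝ, T.MemV p υ →
    0 = T.integral (fun K x =>
          ((mid S S').b K x - (mid S S').lam K x
            - (m.ρ₁ + m.ρ₂) / 8 * (‖S'.v K x‖ ^ 2 + ‖S.v K x‖ ^ 2)) * υ K x)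
  gradient : IsDiscreteGradient T p (mid S S').φ (mid S S').q

/-- The discrete energy. -/
noncomputable def energy (T : Triangulation d Ω) (m : Model) (S : DGState d) : ℝ :=
  T.integral (fun K x =>
    m.W (S.φ K x) + 1 / 2 * m.ρ (S.φ K x) * ‖S.v K x‖ ^ 2 + m.γ / 2 * ‖S.q K x‖ ^ 2)

end DGState

end DGScheme

namespace DGScheme

/-! ### Fubini's theorem along a direction transversal to a hyperplane -/

/-! The identity comes from testing each equation with one particular function. All unknowns below
are midpoint values, primes denote the new time level, and `s = 1/c₊`.

Dissipation: add `s` times the phase equation tested with `a`, the momentum equation tested with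
`v`, and the constraint tested with `b`. In the momentum equation convection drops out, pointwise
inside the elements (`inner_convect`) and on interior faces (`frob_convection`). The transport terms
pair into integrations by parts of `a - c₋ b` against `φ v` and of `b` against `v`, whose face terms
are exactly those of the scheme. What survives says that `k⁻¹ (s ∫(φ' - φ) a + ∫ρ(φ)(v' - v)·v - c₋
s ∫(φ' - φ) b)` is minus the dissipation.

Energy increment: the potential and multiplier equations tested with `φ' - φ` turn `∫W(φ') - ∫W(φ)`
into the terms with `a` and `b`, plus a kinetic correction and a term in `div q`. The kinetic
correction cancels the part of the increment of `½ρ|v|²` that stems from `ρ(φ') - ρ(φ)`, because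
`c₋/c₊ = (ρ₂ - ρ₁)/(ρ₁ + ρ₂)`. The `div q` term cancels the increment of `γ/2 |q|²`: integrate by
parts and test the gradient equation for the increments with `q`. That equation is imposed at
midpoints only, so it is first carried to every time level by induction from the compatible initial
data. `energy_balance` is the resulting linear algebra.

The analytic core is `integral_by_parts`, built on the divergence theorem for a simplex
(`integral_simplex_fderiv`). Along an edge direction the latter is Fubini plus the fundamental
theorem of calculus, and edges span all directions. Summed over the elements, it needs two geometric
facts, both consequences of conformity: the elements at an interior face have opposite normals, and
a face with only one element lies on `∂Ω`, where the boundary conditions of `V₀` and `V_n` remove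
its contribution. -/

theorem measurePreserving_oblique {d : ℕ} (n e x₀ : E d) (hn : ‖n‖ = 1) (he : ⟪n, e⟫ ≠ 0) :
    MeasurePreserving (fun z : ℝ × (ℝ ∙ n)ᗮ => x₀ + (z.2 : E d) + z.1 • e)
      ((ENNReal.ofReal |⟪n, e⟫| • (volume : Measure ℝ)).prod volume) volume := by
  set c := ⟪n, e⟫ with hc
  -- With `w = c⁻¹ e - n`, the vector `t e` equals `(c t) n + (c t) w`. The map is therefore the
  -- scaling `t ↦ c t`, which absorbs the density `|c|`, then the shear `y ↦ y + t w`, then the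
  -- orthogonal decomposition along `n`; the last two preserve Lebesgue measure.
  have hw : c⁻¹ • e - n ∈ (ℝ ∙ n)ᗮ := by
    rw [Submodule.mem_orthogonal_singleton_iff_inner_right, inner_sub_right, inner_smul_right,
      ← hc, inv_mul_cancel₀ he, real_inner_self_eq_norm_sq, hn]
    norm_num
  set w : (ℝ ∙ n)ᗮ := ⟨c⁻¹ • e - n, hw⟩ with hwdef
  have h1 : MeasurePreserving (fun t : ℝ => c * t)
      (ENNReal.ofReal |c| • (volume : Measure ℝ)) volume := by
    refine ⟨by fun_prop, ?_⟩
    rw [Measure.map_smul, Real.map_volume_mul_left he, smul_smul,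
      ← ENNReal.ofReal_mul (abs_nonneg _), ← abs_mul, mul_inv_cancel₀ he]
    simp
  have h2 := h1.prod (MeasurePreserving.id (volume : Measure (ℝ ∙ n)ᗮ))
  have h3 : MeasurePreserving (fun z : ℝ × (ℝ ∙ n)ᗮ => (id z.1, z.2 + z.1 • w))
      ((volume : Measure ℝ).prod volume) ((volume : Measure ℝ).prod volume) :=
    (MeasurePreserving.id (volume : Measure ℝ)).skew_product
      (g := fun t y => y + t • w) (by simp only [Function.uncurry_def]; fun_prop)
      (Filter.Eventually.of_forall fun t => map_add_right_eq_self _ _)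
  have h4 := (LinearIsometryEquiv.toSpanUnitSingleton (𝕜 := ℝ) n hn).measurePreserving.prod
    (MeasurePreserving.id (volume : Measure (ℝ ∙ n)ᗮ))
  have h5 := ((ℝ ∙ n).measurePreserving_measurableEquivProd x₀).symm
  rw [InnerProductSpace.euclideanHausdorffMeasure_eq_volume] at h5
  have h6 := h5.comp (h4.comp (h3.comp h2))
  refine (?_ : (fun z : ℝ × (ℝ ∙ n)ᗮ => x₀ + (z.2 : E d) + z.1 • e) = _) ▸ h6
  funext z
  simp only [Function.comp_apply, Prod.map, id, Submodule.measurableEquivProd_symm_apply,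
    LinearIsometryEquiv.toSpanUnitSingleton_apply, Submodule.coe_add, Submodule.coe_smul, hwdef,
    vadd_eq_add, smul_sub, smul_smul]
  rw [mul_comm c, mul_assoc, mul_inv_cancel₀ he]
  module

theorem finrank_orthogonal_unit {d : ℕ} (n : E d) (hn : ‖n‖ = 1) :
    Module.finrank ℝ (ℝ ∙ n)ᗮ = d - 1 := by
  have h := (ℝ ∙ n).finrank_add_finrank_orthogonal
  rw [finrank_span_singleton (by intro h; simp [h] at hn)] at h
  simp at h
  omega

/-- Isometric embeddings transport Hausdorff measure, and on the `(d-1)`-dimensional space `nᗮ` the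
normalised Hausdorff measure of that dimension is Lebesgue measure. -/
theorem map_hyperplane {d : ℕ} (n x₀ : E d) (hn : ‖n‖ = 1) :
    (volume : Measure (ℝ ∙ n)ᗮ).map (fun y : (ℝ ∙ n)ᗮ => x₀ + (y : E d)) =
      (μHE[d - 1] : Measure (E d)).restrict {x | ⟪n, x - x₀⟫ = 0} := by
  have hiso : Isometry (fun y : (ℝ ∙ n)ᗮ => x₀ + (y : E d)) :=
    (IsometryEquiv.addLeft x₀).isometry.comp isometry_subtype_coe
  have h := hiso.map_euclideanHausdorffMeasure (d := d - 1)
  rw [← InnerProductSpace.euclideanHausdorffMeasure_eq_volume, finrank_orthogonal_unit n hn, h]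
  congr 1
  ext x
  simp only [Set.mem_range, Set.mem_ofPred_eq]
  constructor
  · rintro ⟨y, rfl⟩
    rw [add_sub_cancel_left]
    exact Submodule.mem_orthogonal_singleton_iff_inner_right.1 y.2
  · intro hx
    exact ⟨⟨x - x₀, Submodule.mem_orthogonal_singleton_iff_inner_right.2 hx⟩, by simp⟩

theorem isClosedEmbedding_hyperplane {d : ℕ} (n x₀ : E d) :
    Topology.IsClosedEmbedding (fun y : (ℝ ∙ n)ᗮ => x₀ + (y : E d)) :=
  have hiso : Isometry (fun y : (ℝ ∙ n)ᗮ => x₀ + (y : E d)) :=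
    (IsometryEquiv.addLeft x₀).isometry.comp isometry_subtype_coe
  hiso.isClosedEmbedding

/-- Fubini's theorem: integration over `ℝ^d` as integration over a hyperplane, followed by
integration along lines of direction `e`. -/
theorem integral_eq_hyperplane {d : ℕ} (n e x₀ : E d) (hn : ‖n‖ = 1) (he : ⟪n, e⟫ ≠ 0)
    (g : E d → ℝ) (hg : Integrable g) :
    ∫ z, g z = |⟪n, e⟫| *
      ∫ x in {x | ⟪n, x - x₀⟫ = 0}, (∫ t : ℝ, g (x + t • e)) ∂μHE[d - 1] := by
  have hmp := measurePreserving_oblique n e x₀ hn he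
  rw [← map_hyperplane n x₀ hn, (isClosedEmbedding_hyperplane n x₀).measurableEmbedding.integral_map]
  have hint := hmp.integrable_comp_of_integrable hg
  nth_rw 1 [← hmp.map_eq]
  rw [integral_map hmp.aemeasurable (by rw [hmp.map_eq]; exact hg.aestronglyMeasurable)]
  have := integral_prod_symm _ hint
  simp only [Function.comp_def] at this
  rw [this]
  simp only [integral_smul_measure, ENNReal.toReal_ofReal (abs_nonneg _), smul_eq_mul]
  rw [integral_const_mul]

/-- Supplies integrability on faces. Compactness alone would not do, since `(d-1)`-dimensional
measure is not locally finite on `ℝ^d` when `d ≥ 1`; lying in a hyperplane is essential. -/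
theorem hausdorff_hyperplane_lt_top {d : ℕ} (n x₀ : E d) (hn : ‖n‖ = 1) {s : Set (E d)}
    (hs : IsCompact s) (hsub : s ⊆ {x | ⟪n, x - x₀⟫ = 0}) : μHE[d - 1] s < ⊤ := by
  have h : (μHE[d - 1] : Measure (E d)).restrict {x | ⟪n, x - x₀⟫ = 0} s = μHE[d - 1] s := by
    rw [Measure.restrict_apply hs.measurableSet, Set.inter_eq_left.2 hsub]
  rw [← h, ← map_hyperplane n x₀ hn,
    (isClosedEmbedding_hyperplane n x₀).measurableEmbedding.map_apply]
  exact ((isClosedEmbedding_hyperplane n x₀).isCompact_preimage hs).measure_lt_top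

end DGScheme

namespace DGScheme

/-! ### Integration by parts on a simplex along an edge -/

section EdgeIntegration

variable {d : ℕ} {ι : Type*} (b : AffineBasis ι ℝ (E d))

theorem coord_add (k : ι) (x u : E d) :
    b.coord k (x + u) = b.coord k x + (b.coord k).linear u := by
  rw [add_comm x u, ← vadd_eq_add, AffineMap.map_vadd, vadd_eq_add, add_comm]

theorem coord_linear_sub (k : ι) (x y : E d) :
    (b.coord k).linear (x - y) = b.coord k x - b.coord k y := by
  have := coord_add b k y (x - y)
  rw [add_sub_cancel] at this
  linarith

theorem continuous_coord (k : ι) : Continuous (b.coord k) :=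
  (b.coord k).continuous_of_finiteDimensional

theorem isCompact_simplex [Finite ι] : IsCompact {x | ∀ k, 0 ≤ b.coord k x} := by
  rw [← b.convexHull_eq_nonneg_coord]
  exact (Set.finite_range b).isCompact_convexHull ℝ

theorem isClosed_facet (i : ι) : IsClosed {x | b.coord i x = 0} :=
  isClosed_eq (continuous_coord b i) continuous_const

theorem isCompact_facet [Finite ι] (i : ι) :
    IsCompact {x | (∀ k, 0 ≤ b.coord k x) ∧ b.coord i x = 0} :=
  (isCompact_simplex b).inter_right (isClosed_facet b i)

variable {b} {i j : ι}

/-- Here `n = -c ∇λᵢ` for the barycentric coordinate `λᵢ`. A direction along which `λᵢ` changes at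
unit rate has Jacobian factor `|⟪n, e⟫| = c`; the edge `bᵢ - bⱼ` is such a direction for both `λᵢ`
and `λⱼ`. -/
theorem integral_eq_facet_hyperplane (hij : i ≠ j) {n : E d} (hn : ‖n‖ = 1) {c : ℝ} (hc : 0 < c)
    (hnc : ∀ u, ⟪n, u⟫ = -c * (b.coord i).linear u) {e : E d} (he : |(b.coord i).linear e| = 1)
    {g : E d → ℝ} (hg : Integrable g) :
    ∫ z, g z = c * ∫ x in {x | b.coord i x = 0}, (∫ t : ℝ, g (x + t • e)) ∂μHE[d - 1] := by
  have h0 : (b.coord i).linear e ≠ 0 := by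
    intro h; rw [h, abs_zero] at he; exact zero_ne_one he
  have hne : ⟪n, e⟫ ≠ 0 := by
    rw [hnc]; exact mul_ne_zero (neg_ne_zero.2 hc.ne') h0
  rw [integral_eq_hyperplane n e (b j) hn hne g hg, hnc, abs_mul, abs_neg, abs_of_pos hc, he,
    mul_one]
  congr 3
  ext x
  rw [Set.mem_ofPred_eq, Set.mem_ofPred_eq, hnc, coord_linear_sub, b.coord_apply_ne hij]
  simp [hc.ne']

theorem coord_edge (hij : i ≠ j) : (b.coord i).linear (b i - b j) = 1 := by
  rw [coord_linear_sub, b.coord_apply_eq, b.coord_apply_ne hij, sub_zero]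

theorem coord_edge' (hij : i ≠ j) : (b.coord j).linear (b i - b j) = -1 := by
  rw [coord_linear_sub, b.coord_apply_eq, b.coord_apply_ne hij.symm, zero_sub]

theorem coord_edge_of_ne {k : ι} (hi : k ≠ i) (hj : k ≠ j) :
    (b.coord k).linear (b i - b j) = 0 := by
  rw [coord_linear_sub, b.coord_apply_ne hi, b.coord_apply_ne hj, sub_zero]

/-- Along `bᵢ - bⱼ` the coordinate `λᵢ` grows and `λⱼ` decreases at unit rate while all others stay
fixed. A line starting on the facet `λᵢ = 0` thus leaves the simplex through `λⱼ = 0`, at time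
`λⱼ(x)`. -/
theorem add_edge_mem_simplex_iff (hij : i ≠ j) {x : E d} (hx : b.coord i x = 0) (t : ℝ) :
    x + t • (b i - b j) ∈ {x | ∀ k, 0 ≤ b.coord k x} ↔
      x ∈ {x | (∀ k, 0 ≤ b.coord k x) ∧ b.coord i x = 0} ∧ t ∈ Set.Icc 0 (b.coord j x) := by
  have key : ∀ k, b.coord k (x + t • (b i - b j))
      = b.coord k x + t * (b.coord k).linear (b i - b j) := fun k => by
    rw [coord_add, map_smul, smul_eq_mul]
  simp only [Set.mem_ofPred_eq, Set.mem_Icc, key]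
  constructor
  · intro h
    have h1 := h i
    have h2 := h j
    rw [coord_edge hij, hx] at h1
    rw [coord_edge' hij] at h2
    refine ⟨⟨fun k => ?_, hx⟩, by linarith, by linarith⟩
    by_cases hki : k = i
    · rw [hki, hx]
    by_cases hkj : k = j
    · rw [hkj]; linarith
    have h3 := h k
    rw [coord_edge_of_ne hki hkj] at h3
    linarith
  · rintro ⟨⟨h1, -⟩, h2, h3⟩ k
    by_cases hki : k = i
    · rw [hki, coord_edge hij, hx]; linarith
    by_cases hkj : k = j
    · rw [hkj, coord_edge' hij]; linarith
    rw [coord_edge_of_ne hki hkj]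
    linarith [h1 k]

theorem add_edge_mem_facet_iff (hij : i ≠ j) {x : E d} (hx : b.coord i x = 0) :
    x + b.coord j x • (b i - b j) ∈ {x | (∀ k, 0 ≤ b.coord k x) ∧ b.coord j x = 0} ↔
      x ∈ {x | (∀ k, 0 ≤ b.coord k x) ∧ b.coord i x = 0} := by
  have h := add_edge_mem_simplex_iff hij hx (b.coord j x)
  have h0 : b.coord j (x + b.coord j x • (b i - b j)) = 0 := by
    rw [coord_add, map_smul, coord_edge' hij]; simp
  constructor
  · intro hx'
    exact (h.1 hx'.1).1
  · intro hx'
    exact ⟨h.2 ⟨hx', hx'.1 j, le_rfl⟩, h0⟩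

variable [Finite ι]

/-- Fubini along the edge direction reduces the volume integral to segments joining the two facets,
and the fundamental theorem of calculus evaluates each of them. -/
theorem integral_simplex_edge (hij : i ≠ j) {n : E d} (hn : ‖n‖ = 1) {c : ℝ} (hc : 0 < c)
    (hnc : ∀ u, ⟪n, u⟫ = -c * (b.coord i).linear u) {f : E d → ℝ} (hf : ContDiff ℝ 1 f) :
    ∫ x in {x | ∀ k, 0 ≤ b.coord k x}, fderiv ℝ f x (b i - b j) =
      c * ∫ x in {x | (∀ k, 0 ≤ b.coord k x) ∧ b.coord i x = 0},
        (f (x + b.coord j x • (b i - b j)) - f x) ∂μHE[d - 1] := by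
  set e := b i - b j with he
  have hcont : Continuous fun x => fderiv ℝ f x e :=
    (hf.continuous_fderiv one_ne_zero).clm_apply continuous_const
  have hS := isCompact_simplex b
  have hint : Integrable ({x | ∀ k, 0 ≤ b.coord k x}.indicator fun x => fderiv ℝ f x e) :=
    (hcont.continuousOn.integrableOn_compact hS).integrable_indicator hS.measurableSet
  rw [← integral_indicator hS.measurableSet,
    integral_eq_facet_hyperplane hij hn hc hnc (e := e) (by rw [he, coord_edge hij, abs_one]) hint]
  congr 1
  have hinner : ∀ x ∈ {x | b.coord i x = 0},
      (∫ t : ℝ, ({x | ∀ k, 0 ≤ b.coord k x}.indicator fun x => fderiv ℝ f x e) (x + t • e)) =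
      {x | (∀ k, 0 ≤ b.coord k x) ∧ b.coord i x = 0}.indicator
        (fun x => f (x + b.coord j x • e) - f x) x := by
    intro x hx
    by_cases hxF : x ∈ {x | (∀ k, 0 ≤ b.coord k x) ∧ b.coord i x = 0}
    · rw [Set.indicator_of_mem hxF]
      have : ∀ t : ℝ, ({x | ∀ k, 0 ≤ b.coord k x}.indicator fun x => fderiv ℝ f x e) (x + t • e)
          = (Set.Icc 0 (b.coord j x)).indicator (fun t => fderiv ℝ f (x + t • e) e) t := by
        intro t
        have := add_edge_mem_simplex_iff hij hx t
        by_cases ht : t ∈ Set.Icc 0 (b.coord j x)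
        · rw [Set.indicator_of_mem ht, Set.indicator_of_mem (this.2 ⟨hxF, ht⟩)]
        · rw [Set.indicator_of_notMem ht, Set.indicator_of_notMem fun h => ht (this.1 h).2]
      simp_rw [this]
      rw [integral_indicator measurableSet_Icc, integral_Icc_eq_integral_Ioc,
        ← intervalIntegral.integral_of_le (hxF.1 j),
        intervalIntegral.integral_eq_sub_of_hasDerivAt (f := fun t : ℝ => f (x + t • e))]
      · simp
      · intro t _
        have h1 : HasDerivAt (fun t : ℝ => x + t • e) e t := by
          simpa using ((hasDerivAt_id t).smul_const e).const_add x
        exact ((hf.differentiable one_ne_zero).differentiableAt.hasFDerivAt).comp_hasDerivAt t h1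
      · exact (hcont.comp (by fun_prop : Continuous fun t : ℝ => x + t • e)).intervalIntegrable _ _
    · rw [Set.indicator_of_notMem hxF]
      have : ∀ t : ℝ, ({x | ∀ k, 0 ≤ b.coord k x}.indicator fun x => fderiv ℝ f x e) (x + t • e)
          = 0 := fun t =>
        Set.indicator_of_notMem (fun h => hxF ((add_edge_mem_simplex_iff hij hx t).1 h).1) _
      simp [this]
  rw [setIntegral_congr_fun (isClosed_facet b i).measurableSet hinner,
    setIntegral_indicator (isCompact_facet b i).measurableSet]
  congr 2
  ext x
  simp +contextual

/-- Change of variables for the projection along the edge from one facet to the other. It is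
obtained without a Jacobian formula for surface measure: one volume integral is computed by Fubini
over each of the two facet hyperplanes. -/
theorem integral_facet_eq_facet (hij : i ≠ j) {n n' : E d} (hn : ‖n‖ = 1) (hn' : ‖n'‖ = 1)
    {c c' : ℝ} (hc : 0 < c) (hc' : 0 < c')
    (hnc : ∀ u, ⟪n, u⟫ = -c * (b.coord i).linear u)
    (hnc' : ∀ u, ⟪n', u⟫ = -c' * (b.coord j).linear u) {f : E d → ℝ} (hf : Continuous f) :
    c * ∫ x in {x | (∀ k, 0 ≤ b.coord k x) ∧ b.coord i x = 0},
        f (x + b.coord j x • (b i - b j)) ∂μHE[d - 1] =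
      c' * ∫ x in {x | (∀ k, 0 ≤ b.coord k x) ∧ b.coord j x = 0}, f x ∂μHE[d - 1] := by
  set e := b i - b j with he
  set Fi : Set (E d) := {x | (∀ k, 0 ≤ b.coord k x) ∧ b.coord i x = 0} with hFi
  set Fj : Set (E d) := {x | (∀ k, 0 ≤ b.coord k x) ∧ b.coord j x = 0} with hFj
  have hFic : IsCompact Fi := isCompact_facet b i
  have hFjc : IsCompact Fj := isCompact_facet b j
  set π : E d → E d := fun z => z + b.coord j z • e with hπ
  have hci := continuous_coord b i
  have hcj := continuous_coord b j
  have hπc : Continuous π := by fun_prop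
  -- The integrand `f ∘ π` is constant along lines in direction `e`. Each line that meets `C` does
  -- so in a parameter interval of length one, since `λᵢ` runs through `[0, 1]`. Integrating along
  -- the lines thus returns the value of `f` on the facet.
  set C : Set (E d) := {z | π z ∈ Fj ∧ b.coord i z ∈ Set.Icc (0 : ℝ) 1} with hC
  have hCclosed : IsClosed C := (hFjc.isClosed.preimage hπc).inter (isClosed_Icc.preimage hci)
  have hiπ : ∀ z, b.coord i (π z) = b.coord i z + b.coord j z := fun z => by
    rw [hπ]; simp only; rw [coord_add, map_smul, he, coord_edge hij]; simp
  -- A point of `C` is `π z - λⱼ(z) e`. Both `λᵢ(z)` and `λᵢ(π z) = λᵢ(z) + λⱼ(z)` lie in `[0, 1]`,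
  -- so `λⱼ(z)` lies in `[-1, 1]`.
  have hCcompact : IsCompact C := by
    refine ((hFjc.prod (isCompact_Icc (a := (-1 : ℝ)) (b := 1))).image
      (f := fun z : E d × ℝ => z.1 - z.2 • e) (by fun_prop)).of_isClosed_subset hCclosed ?_
    rintro z ⟨hz, hz0, hz1⟩
    refine ⟨(π z, b.coord j z), ⟨hz, ?_, ?_⟩, by simp [hπ]⟩
    · have := hz.1 i
      rw [hiπ] at this
      simp only; linarith
    · have hs : b.coord i (π z) ≤ 1 := by
        have := Fintype.ofFinite ι
        rw [← b.sum_coord_apply_eq_one (π z)]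
        exact Finset.single_le_sum (f := fun k => b.coord k (π z)) (fun k _ => hz.1 k)
          (Finset.mem_univ i)
      rw [hiπ] at hs
      simp only; linarith
  have hint : Integrable (C.indicator fun z => f (π z)) :=
    ((hf.comp hπc).continuousOn.integrableOn_compact hCcompact).integrable_indicator
      hCcompact.measurableSet
  have hindic : ∀ (x : E d) (s : Set (E d)) (y : E d) (a : ℝ),
      (∀ t : ℝ, π (x + t • e) = y ∧
        (x + t • e ∈ C ↔ x ∈ s ∧ t ∈ Set.Icc a (a + 1))) →
      (∫ t : ℝ, (C.indicator fun z => f (π z)) (x + t • e)) = s.indicator (fun _ => f y) x := by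
    intro x s y a h
    by_cases hxs : x ∈ s
    · have : ∀ t : ℝ, (C.indicator fun z => f (π z)) (x + t • e)
          = (Set.Icc a (a + 1)).indicator (fun _ => f y) t := by
        intro t
        by_cases ht : t ∈ Set.Icc a (a + 1)
        · rw [Set.indicator_of_mem ht, Set.indicator_of_mem ((h t).2.2 ⟨hxs, ht⟩), (h t).1]
        · rw [Set.indicator_of_notMem ht, Set.indicator_of_notMem fun h' => ht ((h t).2.1 h').2]
      simp_rw [this]
      rw [integral_indicator measurableSet_Icc, Set.indicator_of_mem hxs]
      simp
    · have : ∀ t : ℝ, (C.indicator fun z => f (π z)) (x + t • e) = 0 := fun t =>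
        Set.indicator_of_notMem (fun h' => hxs ((h t).2.1 h').1) _
      simp [this, hxs]
  have hi : ∀ x ∈ {x | b.coord i x = 0},
      (∫ t : ℝ, (C.indicator fun z => f (π z)) (x + t • e)) =
        Fi.indicator (fun x => f (x + b.coord j x • e)) x := by
    intro x hx
    rw [hindic x Fi (π x) 0]
    · rfl
    · intro t
      have hπt : π (x + t • e) = π x := by
        rw [hπ]; simp only
        rw [coord_add, map_smul, he, coord_edge' hij]
        simp only [smul_eq_mul]; module
      refine ⟨hπt, ?_⟩
      have h1 : b.coord i (x + t • e) = t := by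
        rw [coord_add, map_smul, he, coord_edge hij, hx]; simp
      have h2 : π x ∈ Fj ↔ x ∈ Fi := add_edge_mem_facet_iff hij hx
      simp only [hC, Set.mem_ofPred_eq] at h1 h2 ⊢
      rw [hπt, h1, h2, zero_add]
  have hj : ∀ x ∈ {x | b.coord j x = 0},
      (∫ t : ℝ, (C.indicator fun z => f (π z)) (x + t • e)) = Fj.indicator f x := by
    intro x hx
    rw [hindic x Fj x (-b.coord i x)]
    · rfl
    · intro t
      have hπt : π (x + t • e) = x := by
        rw [hπ]; simp only
        rw [coord_add, map_smul, he, coord_edge' hij, hx]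
        simp only [smul_eq_mul]; module
      refine ⟨hπt, ?_⟩
      have h1 : b.coord i (x + t • e) = b.coord i x + t := by
        rw [coord_add, map_smul, he, coord_edge hij]; simp
      simp only [hC, Set.mem_ofPred_eq, Set.mem_Icc] at h1 ⊢
      rw [hπt, h1]
      constructor
      · rintro ⟨h, h', h''⟩; exact ⟨h, by linarith, by linarith⟩
      · rintro ⟨h, h', h''⟩; exact ⟨h, by linarith, by linarith⟩
  have e1 := integral_eq_facet_hyperplane hij hn hc hnc
    (e := e) (by rw [he, coord_edge hij, abs_one]) hint
  have e2 := integral_eq_facet_hyperplane hij.symm hn' hc' hnc'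
    (e := e) (by rw [he, coord_edge' hij, abs_neg, abs_one]) hint
  rw [setIntegral_congr_fun (isClosed_facet b i).measurableSet hi,
    setIntegral_indicator hFic.measurableSet] at e1
  rw [setIntegral_congr_fun (isClosed_facet b j).measurableSet hj,
    setIntegral_indicator hFjc.measurableSet] at e2
  have s1 : {x | b.coord i x = 0} ∩ Fi = Fi := Set.inter_eq_right.2 fun x hx => hx.2
  have s2 : {x | b.coord j x = 0} ∩ Fj = Fj := Set.inter_eq_right.2 fun x hx => hx.2
  rw [s1] at e1
  rw [s2] at e2
  rw [← e1, ← e2]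

end EdgeIntegration

end DGScheme

namespace DGScheme

/-! ### Simplices given by their vertices -/

section Simplex

open Classical

variable {d : ℕ} {K : Finset (E d)}

/-- The barycentric coordinate system of a nondegenerate simplex. -/
noncomputable def simplexBasis (hK : K.card = d + 1)
    (hi : AffineIndependent ℝ ((↑) : K → E d)) : AffineBasis K ℝ (E d) :=
  ⟨(↑), hi, by
    have h := hi.affineSpan_eq_top_iff_card_eq_finrank_add_one
    rw [h]; simp [hK]⟩

variable (hK : K.card = d + 1) (hi : AffineIndependent ℝ ((↑) : K → E d))

theorem simplexBasis_apply (k : K) : simplexBasis hK hi k = (k : E d) := rfl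

theorem coe_simplexBasis : ⇑(simplexBasis hK hi) = ((↑) : K → E d) := rfl

theorem simplexBasis_coord (i k : K) :
    (simplexBasis hK hi).coord i (k : E d) = if i = k then 1 else 0 :=
  (simplexBasis hK hi).coord_apply i k

theorem convexHull_cell :
    convexHull ℝ (K : Set (E d)) = {x | ∀ k, 0 ≤ (simplexBasis hK hi).coord k x} := by
  rw [← AffineBasis.convexHull_eq_nonneg_coord, coe_simplexBasis, Subtype.range_coe]

theorem coord_eq_zero_of_mem_convexHull {s : Set (E d)} (hs : s ⊆ K) (k : K) (hk : (k : E d) ∉ s)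
    {x : E d} (hx : x ∈ convexHull ℝ s) : (simplexBasis hK hi).coord k x = 0 := by
  have hconv : Convex ℝ {x | (simplexBasis hK hi).coord k x = 0} :=
    (convex_singleton (0 : ℝ)).affine_preimage ((simplexBasis hK hi).coord k)
  refine convexHull_min (fun y hy => ?_) hconv hx
  have := simplexBasis_coord hK hi k ⟨y, hs hy⟩
  rw [if_neg] at this
  · exact this
  · rintro rfl; exact hk hy

theorem convexHull_erase (i : K) :
    convexHull ℝ ((K.erase i : Finset (E d)) : Set (E d)) =
      {x | (∀ k, 0 ≤ (simplexBasis hK hi).coord k x) ∧ (simplexBasis hK hi).coord i x = 0} := by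
  ext x
  constructor
  · intro hx
    have hsub : ((K.erase i : Finset (E d)) : Set (E d)) ⊆ K :=
      Finset.coe_subset.2 (Finset.erase_subset _ _)
    have h1 := convexHull_mono hsub hx
    rw [convexHull_cell hK hi] at h1
    exact ⟨h1, coord_eq_zero_of_mem_convexHull hK hi hsub i (by simp) hx⟩
  · rintro ⟨h1, h2⟩
    have hx := (simplexBasis hK hi).linear_combination_coord_eq_self x
    have hs := (simplexBasis hK hi).sum_coord_apply_eq_one x
    rw [← hx]
    rw [← Finset.add_sum_erase _ _ (Finset.mem_univ i), h2, zero_smul, zero_add]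
    rw [← Finset.add_sum_erase _ _ (Finset.mem_univ i), h2, zero_add] at hs
    refine (convex_convexHull ℝ _).sum_mem (fun k _ => h1 k) hs fun k hk => ?_
    refine subset_convexHull ℝ _ ?_
    rw [simplexBasis_apply]
    have : (k : E d) ≠ i := fun h => (Finset.mem_erase.1 hk).1 (Subtype.ext h)
    simp [this]

/-- The linear parts `dλₖ` sum to zero, so `u = ∑ dλₖ(u) (bₖ - p)` for any base point `p`. With `p`
a vertex of the facet, which exists since `d > 0`, only the term of the vertex opposite the facet
leaves its direction space. -/
theorem coord_linear_eq_zero_iff (hd : 0 < d) (i : K) (u : E d) :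
    ((simplexBasis hK hi).coord i).linear u = 0 ↔
      u ∈ vectorSpan ℝ ((K.erase i : Finset (E d)) : Set (E d)) := by
  set b := simplexBasis hK hi with hb
  constructor
  · intro h
    have hne : (K.erase (i : E d)).Nonempty := by
      rw [← Finset.card_pos, Finset.card_erase_of_mem i.2, hK]; omega
    obtain ⟨p, hp⟩ := hne
    have h1 : u = ∑ k, (b.coord k).linear u • (b k - p) := by
      have hu := b.linear_combination_coord_eq_self u
      have h0 := b.linear_combination_coord_eq_self 0
      have hsu := b.sum_coord_apply_eq_one u
      have hs0 := b.sum_coord_apply_eq_one 0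
      have hlin : ∀ k, (b.coord k).linear u = b.coord k u - b.coord k 0 := fun k => by
        rw [← coord_linear_sub, sub_zero]
      simp_rw [hlin, smul_sub, Finset.sum_sub_distrib, sub_smul, Finset.sum_sub_distrib]
      rw [hu, h0, ← Finset.sum_smul, ← Finset.sum_smul, hsu, hs0]
      simp
    rw [h1]
    refine Submodule.sum_mem _ fun k _ => ?_
    by_cases hki : k = i
    · rw [hki, h, zero_smul]; exact Submodule.zero_mem _
    · refine Submodule.smul_mem _ _ (vsub_mem_vectorSpan ℝ ?_ hp)
      have : (k : E d) ≠ i := fun h => hki (Subtype.ext h)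
      simp [hb, simplexBasis_apply, this]
  · intro h
    have hle : vectorSpan ℝ ((K.erase i : Finset (E d)) : Set (E d)) ≤
        LinearMap.ker (b.coord i).linear := by
      rw [vectorSpan_def, Submodule.span_le]
      rintro _ ⟨x, hx, y, hy, rfl⟩
      have hz : ∀ z ∈ ((K.erase i : Finset (E d)) : Set (E d)), b.coord i z = 0 := fun z hz =>
        ((convexHull_erase hK hi i).subset (subset_convexHull ℝ _ hz)).2
      simp only [vsub_eq_sub, SetLike.mem_coe, LinearMap.mem_ker]
      rw [coord_linear_sub, hz x hx, hz y hy, sub_zero]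
    exact hle h

theorem coord_centroid {s : Finset (E d)} (hs : s.Nonempty) (hsK : s ⊆ K) (i : K) :
    (simplexBasis hK hi).coord i (s.centroid ℝ id) =
      if (i : E d) ∈ s then (s.card : ℝ)⁻¹ else 0 := by
  have h1 := s.sum_centroidWeights_eq_one_of_nonempty ℝ hs
  rw [Finset.centroid_def, Finset.map_affineCombination _ _ _ h1,
    Finset.affineCombination_eq_linear_combination _ _ _ h1]
  simp only [Finset.centroidWeights_apply, Function.comp_apply, id, smul_eq_mul]
  rw [← Finset.mul_sum]
  have h2 : ∀ x ∈ s, (simplexBasis hK hi).coord i x = if x = (i : E d) then 1 else 0 := by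
    intro x hx
    rw [show x = ((⟨x, hsK hx⟩ : K) : E d) from rfl, simplexBasis_coord]
    simp [Subtype.ext_iff, eq_comm]
  rw [Finset.sum_congr rfl h2]
  simp

/-- The outward normal is a negative multiple of the gradient of the barycentric coordinate. -/
theorem outwardNormal_spec (hd : 0 < d) (i : K) :
    ‖outwardNormal K (K.erase i)‖ = 1 ∧ ∃ c : ℝ, 0 < c ∧
      ∀ u, ⟪outwardNormal K (K.erase i), u⟫ = -c * ((simplexBasis hK hi).coord i).linear u := by
  set b := simplexBasis hK hi with hb
  set w := (K.erase (i : E d)).centroid ℝ id - K.centroid ℝ id with hw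
  set U := vectorSpan ℝ ((K.erase i : Finset (E d)) : Set (E d)) with hU
  have hcard : (K.erase (i : E d)).card = d := by
    rw [Finset.card_erase_of_mem i.2, hK]; rfl
  have hlw : (b.coord i).linear w = -((d : ℝ) + 1)⁻¹ := by
    rw [hw, coord_linear_sub, hb, coord_centroid hK hi _ (Finset.erase_subset _ _),
      coord_centroid hK hi ⟨i, i.2⟩ subset_rfl]
    · simp [hK]
    · rw [← Finset.card_pos, hcard]; exact hd
  have hpos : (0 : ℝ) < (d : ℝ) + 1 := by positivity
  have hlw0 : (b.coord i).linear w ≠ 0 := by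
    rw [hlw]; exact neg_ne_zero.2 (inv_ne_zero hpos.ne')
  set q := Uᗮ.starProjection w with hq
  have hqU : q ∈ Uᗮ := Submodule.starProjection_apply_mem _ _
  have hq0 : q ≠ 0 := by
    intro h
    rw [hq, Submodule.starProjection_apply_eq_zero_iff, Submodule.orthogonal_orthogonal] at h
    exact hlw0 ((coord_linear_eq_zero_iff hK hi hd i w).2 h)
  have hqw : ⟪q, w⟫ = ‖q‖ ^ 2 := by
    have h1 : ⟪q, w - q⟫ = 0 := by
      have := Submodule.sub_starProjection_mem_orthogonal (K := Uᗮ) w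
      exact this q hqU
    rw [inner_sub_right, real_inner_self_eq_norm_sq] at h1
    linarith
  have hqn : 0 < ‖q‖ := norm_pos_iff.2 hq0
  have hout : outwardNormal K (K.erase i) = ‖q‖⁻¹ • q := rfl
  -- Modulo the facet direction, `u` is the multiple `dλᵢ(u)/dλᵢ(w)` of `w`, and `dλᵢ(w) =
  -- -1/(d+1)`. Hence `⟪q, u⟫ = -(d+1) ‖q‖² dλᵢ(u)`; normalising `q` removes one factor `‖q‖`.
  refine ⟨?_, ‖q‖ * ((d : ℝ) + 1), by positivity, fun u => ?_⟩
  · rw [hout, norm_smul, norm_inv, norm_norm, inv_mul_cancel₀ hqn.ne']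
  · have h1 : u - ((b.coord i).linear u / (b.coord i).linear w) • w ∈ U := by
      rw [← coord_linear_eq_zero_iff hK hi hd, map_sub, map_smul, smul_eq_mul, ← hb,
        div_mul_cancel₀ _ hlw0, sub_self]
    have h2 : ⟪q, u - ((b.coord i).linear u / (b.coord i).linear w) • w⟫ = 0 := by
      rw [real_inner_comm]; exact hqU _ h1
    rw [inner_sub_right, inner_smul_right, hqw, hlw, sub_eq_zero] at h2
    rw [hout, inner_smul_left, h2]
    simp only [conj_trivial]
    field_simp

include hK hi in
/-- The divergence theorem on a simplex, in direction `u`. -/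
theorem integral_simplex_fderiv (hd : 0 < d) {f : E d → ℝ} (hf : ContDiff ℝ 1 f) (u : E d) :
    ∫ x in convexHull ℝ (K : Set (E d)), fderiv ℝ f x u =
      ∑ i : K, ⟪outwardNormal K (K.erase i), u⟫ *
        ∫ x in convexHull ℝ ((K.erase i : Finset (E d)) : Set (E d)), f x ∂μHE[d - 1] := by
  set b := simplexBasis hK hi with hb
  choose hn c hc hnc using outwardNormal_spec hK hi hd
  have hcell := convexHull_cell hK hi
  have hcompact : IsCompact (convexHull ℝ (K : Set (E d))) := K.finite_toSet.isCompact_convexHull ℝ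
  have hint : ∀ u, IntegrableOn (fun x => fderiv ℝ f x u) (convexHull ℝ (K : Set (E d))) :=
    fun u => (((hf.continuous_fderiv one_ne_zero).clm_apply
      continuous_const).continuousOn).integrableOn_compact hcompact
  -- The defect of the identity is linear in `u`, so it suffices that it vanishes on the edges `bᵢ -
  -- bⱼ` for one fixed `j`, which span.
  let Λ : E d →ₗ[ℝ] ℝ :=
    { toFun := fun u => (∫ x in convexHull ℝ (K : Set (E d)), fderiv ℝ f x u) -
        ∑ i : K, ⟪outwardNormal K (K.erase i), u⟫ *
          ∫ x in convexHull ℝ ((K.erase i : Finset (E d)) : Set (E d)), f x ∂μHE[d - 1]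
      map_add' := fun u v => by
        simp only [map_add, inner_add_right, add_mul, Finset.sum_add_distrib]
        rw [integral_add (hint u) (hint v)]
        ring
      map_smul' := fun r u => by
        simp only [map_smul, inner_smul_right, smul_eq_mul, RingHom.id_apply]
        rw [integral_const_mul, mul_sub, Finset.mul_sum]
        simp only [mul_assoc] }
  suffices hΛ : Λ = 0 from sub_eq_zero.1 (LinearMap.congr_fun hΛ u)
  have hne : Nonempty K := by
    have : K.Nonempty := by rw [← Finset.card_pos, hK]; omega
    exact this.to_subtype
  obtain ⟨j⟩ := hne
  have hspan : Submodule.span ℝ (Set.range fun i : K => b i - b j) = ⊤ := by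
    have := vectorSpan_range_eq_span_range_vsub_right ℝ b j
    simp only [vsub_eq_sub] at this
    rw [← this, ← direction_affineSpan, b.tot, AffineSubspace.direction_top]
  refine LinearMap.ext_on_range hspan fun i => ?_
  by_cases hij : i = j
  · subst hij; simp
  change _ - _ = (0 : ℝ)
  rw [sub_eq_zero]
  have hFint : IntegrableOn f {x | (∀ k, 0 ≤ b.coord k x) ∧ b.coord i x = 0} μHE[d - 1] := by
    refine hf.continuous.continuousOn.integrableOn_of_subset_isCompact
      (isCompact_facet b i) (isCompact_facet b i).measurableSet subset_rfl ?_
    refine (hausdorff_hyperplane_lt_top _ (b j) (hn i) (isCompact_facet b i) fun x hx => ?_).ne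
    rw [Set.mem_ofPred_eq, hnc i, coord_linear_sub, ← hb, hx.2, b.coord_apply_ne hij]
    simp
  have hFint' : IntegrableOn (fun x => f (x + b.coord j x • (b i - b j)))
      {x | (∀ k, 0 ≤ b.coord k x) ∧ b.coord i x = 0} μHE[d - 1] := by
    have hcj := continuous_coord b j
    refine (hf.continuous.comp (by fun_prop)).continuousOn.integrableOn_of_subset_isCompact
      (isCompact_facet b i) (isCompact_facet b i).measurableSet subset_rfl ?_
    refine (hausdorff_hyperplane_lt_top _ (b j) (hn i) (isCompact_facet b i) fun x hx => ?_).ne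
    rw [Set.mem_ofPred_eq, hnc i, coord_linear_sub, ← hb, hx.2, b.coord_apply_ne hij]
    simp
  rw [hcell, integral_simplex_edge hij (hn i) (hc i) (hnc i) hf, integral_sub hFint' hFint, mul_sub,
    integral_facet_eq_facet hij (hn i) (hn j) (hc i) (hc j) (hnc i) (hnc j) hf.continuous]
  -- Every facet other than those opposite `i` and `j` contains the edge, so its normal is
  -- orthogonal to `bᵢ - bⱼ`.
  rw [Finset.sum_eq_add i j hij]
  · rw [hnc, hnc, ← hb, coord_edge hij, coord_edge' hij, convexHull_erase hK hi,
      convexHull_erase hK hi]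
    ring
  · rintro k - ⟨hki, hkj⟩
    rw [hnc, ← hb, coord_edge_of_ne hki hkj]; simp
  · simp
  · simp

end Simplex

end DGScheme

namespace DGScheme

namespace Triangulation

/-! ### The faces of a triangulation -/

section Faces

open Classical Filter Topology

variable {d : ℕ} {Ω : Set (E d)} (T : Triangulation d Ω)

variable {T} {F K J : Finset (E d)}

theorem card_of_mem_faces (hF : F ∈ T.faces) : F.card = d := by
  obtain ⟨K, -, hK⟩ := Finset.mem_biUnion.1 hF
  exact (Finset.mem_powersetCard.1 hK).2

theorem mem_cellsAt : K ∈ T.cellsAt F ↔ K ∈ T.cells ∧ F ⊆ K := Finset.mem_filter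

theorem exists_eq_erase (hF : F.card = d) (hK : K ∈ T.cellsAt F) :
    ∃ i : K, F = K.erase i := by
  obtain ⟨hKc, hFK⟩ := mem_cellsAt.1 hK
  have hcard : (K \ F).card = 1 := by
    rw [Finset.card_sdiff_of_subset hFK, T.card_cell K hKc, hF]; omega
  obtain ⟨i, hi⟩ := Finset.card_eq_one.1 hcard
  have hiK : i ∈ K := (Finset.mem_sdiff.1 (hi ▸ Finset.mem_singleton_self i)).1
  refine ⟨⟨i, hiK⟩, ?_⟩
  rw [← Finset.sdiff_singleton_eq_erase, ← hi, Finset.sdiff_sdiff_eq_self hFK]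

theorem norm_outwardNormal (hd : 0 < d) (hF : F.card = d) (hK : K ∈ T.cellsAt F) :
    ‖outwardNormal K F‖ = 1 := by
  obtain ⟨i, rfl⟩ := exists_eq_erase hF hK
  have hKc := (mem_cellsAt.1 hK).1
  exact (outwardNormal_spec (T.card_cell K hKc) (T.affineIndependent_cell K hKc) hd i).1

theorem inner_outwardNormal_eq_zero_iff (hd : 0 < d) (hF : F.card = d) (hK : K ∈ T.cellsAt F)
    (u : E d) : ⟪outwardNormal K F, u⟫ = 0 ↔ u ∈ vectorSpan ℝ (F : Set (E d)) := by
  obtain ⟨i, rfl⟩ := exists_eq_erase hF hK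
  have hKc := (mem_cellsAt.1 hK).1
  obtain ⟨c, hc, hnc⟩ :=
    (outwardNormal_spec (T.card_cell K hKc) (T.affineIndependent_cell K hKc) hd i).2
  rw [hnc, ← coord_linear_eq_zero_iff (T.card_cell K hKc) (T.affineIndependent_cell K hKc) hd i]
  simp [hc.ne']

/-- Both normals have the direction space of `F` as their orthogonal complement. The component of
`n'` orthogonal to `n` lies in that space, hence is also orthogonal to `n'`, and so it vanishes. -/
theorem outwardNormal_eq_or_eq_neg (hd : 0 < d) (hF : F.card = d) (hK : K ∈ T.cellsAt F)
    (hJ : J ∈ T.cellsAt F) :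
    outwardNormal J F = outwardNormal K F ∨ outwardNormal J F = -outwardNormal K F := by
  have nK := norm_outwardNormal hd hF hK
  have nJ := norm_outwardNormal hd hF hJ
  have iK := inner_outwardNormal_eq_zero_iff hd hF hK
  have iJ := inner_outwardNormal_eq_zero_iff hd hF hJ
  set n := outwardNormal K F
  set n' := outwardNormal J F
  have h1 : ⟪n, n' - ⟪n, n'⟫ • n⟫ = 0 := by
    rw [inner_sub_right, inner_smul_right, real_inner_self_eq_norm_sq, nK]; ring
  have h2 : ⟪n', n' - ⟪n, n'⟫ • n⟫ = 0 := (iJ _).2 ((iK _).1 h1)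
  have h3 : n' - ⟪n, n'⟫ • n = 0 := by
    rw [← inner_self_eq_zero (𝕜 := ℝ)]
    nth_rw 1 [inner_sub_left]
    rw [inner_smul_left, h1, h2]; simp
  rw [sub_eq_zero] at h3
  have h4 : |⟪n, n'⟫| = 1 := by
    have := congrArg norm h3
    rwa [norm_smul, nK, nJ, mul_one, Real.norm_eq_abs, eq_comm] at this
  rcases eq_or_eq_neg_of_abs_eq h4 with h | h
  · left; rw [h3, h, one_smul]
  · right; rw [h3, h, neg_one_smul]

/-- Moving inwards from the barycentre of a face one stays in the element. -/
theorem eventually_mem_cell (hd : 0 < d) (hF : F.card = d) (hK : K ∈ T.cellsAt F) :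
    ∀ᶠ t : ℝ in 𝓝[>] 0, F.centroid ℝ id - t • outwardNormal K F ∈ convexHull ℝ (K : Set (E d)) ∧
      F.centroid ℝ id - t • outwardNormal K F ∉ convexHull ℝ (F : Set (E d)) := by
  obtain ⟨i, rfl⟩ := exists_eq_erase hF hK
  have hKc := (mem_cellsAt.1 hK).1
  obtain ⟨hn, c, hc, hnc⟩ :=
    outwardNormal_spec (T.card_cell K hKc) (T.affineIndependent_cell K hKc) hd i
  rw [convexHull_cell (T.card_cell K hKc) (T.affineIndependent_cell K hKc),
    convexHull_erase (T.card_cell K hKc) (T.affineIndependent_cell K hKc)]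
  set b := simplexBasis (T.card_cell K hKc) (T.affineIndependent_cell K hKc) with hb
  set n := outwardNormal K (K.erase (i : E d))
  have hne : (K.erase (i : E d)).Nonempty := by rw [← Finset.card_pos, hF]; exact hd
  have hcen := coord_centroid (T.card_cell K hKc) (T.affineIndependent_cell K hKc) hne
    (Finset.erase_subset _ _)
  rw [← hb] at hcen
  have hli : (b.coord i).linear n < 0 := by
    have := hnc n
    rw [real_inner_self_eq_norm_sq, hn] at this
    by_contra! h
    nlinarith
  have hexp : ∀ (k : K) (t : ℝ), b.coord k ((K.erase (i : E d)).centroid ℝ id - t • n) =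
      b.coord k ((K.erase (i : E d)).centroid ℝ id) - t * (b.coord k).linear n := by
    intro k t
    rw [sub_eq_add_neg, coord_add, map_neg, map_smul, smul_eq_mul, sub_eq_add_neg]
  have hall : ∀ k : K, ∀ᶠ t : ℝ in 𝓝[>] 0,
      0 ≤ b.coord k ((K.erase (i : E d)).centroid ℝ id - t • n) := by
    intro k
    simp_rw [hexp]
    by_cases hki : k = i
    · subst hki
      filter_upwards [self_mem_nhdsWithin] with t ht
      rw [hcen]
      simp only [Finset.mem_erase, ne_eq, not_true_eq_false, false_and, if_false]
      have : 0 < t := ht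
      nlinarith
    · have hpos : 0 < b.coord k ((K.erase (i : E d)).centroid ℝ id) := by
        rw [hcen, if_pos (Finset.mem_erase.2 ⟨fun h => hki (Subtype.ext h), k.2⟩), hF]
        positivity
      have hcont : Tendsto (fun t : ℝ => b.coord k ((K.erase (i : E d)).centroid ℝ id) -
          t * (b.coord k).linear n) (𝓝[>] 0)
          (𝓝 (b.coord k ((K.erase (i : E d)).centroid ℝ id) - 0 * (b.coord k).linear n)) :=
        (Continuous.tendsto (by fun_prop) 0).mono_left nhdsWithin_le_nhds
      rw [zero_mul, sub_zero] at hcont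
      exact (hcont.eventually (lt_mem_nhds hpos)).mono fun t ht => ht.le
  filter_upwards [eventually_all.2 hall, self_mem_nhdsWithin] with t ht ht0
  refine ⟨ht, fun h => ?_⟩
  have h1 := h.2
  rw [hexp, hcen] at h1
  simp only [Finset.mem_erase, ne_eq, not_true_eq_false, false_and, if_false] at h1
  have : 0 < t := ht0
  nlinarith

/-- Distinct elements lie on different sides of a common face. -/
theorem eq_of_outwardNormal_eq (hd : 0 < d) (hF : F.card = d) (hK : K ∈ T.cellsAt F)
    (hJ : J ∈ T.cellsAt F) (h : outwardNormal K F = outwardNormal J F) : K = J := by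
  by_contra hne
  have e1 := eventually_mem_cell hd hF hK
  have e2 := eventually_mem_cell hd hF hJ
  rw [← h] at e2
  -- A point slightly inside, off `F`, would belong to both elements. By conformity it would lie in
  -- the simplex on their common vertices, which are exactly those of `F`.
  obtain ⟨t, ⟨h1, h2⟩, h3, -⟩ := (e1.and e2).exists
  have hKc := mem_cellsAt.1 hK
  have hJc := mem_cellsAt.1 hJ
  have hmem := (T.conforming K hKc.1 J hJc.1).subset ⟨h1, h3⟩
  have hinter : F = K ∩ J := by
    refine Finset.eq_of_subset_of_card_le (Finset.subset_inter hKc.2 hJc.2) ?_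
    rw [hF]
    have hlt : (K ∩ J).card < K.card := by
      refine Finset.card_lt_card (Finset.ssubset_iff_subset_ne.2 ⟨Finset.inter_subset_left, ?_⟩)
      intro heq
      refine hne (Finset.eq_of_subset_of_card_le (Finset.inter_eq_left.1 heq) ?_)
      rw [T.card_cell K hKc.1, T.card_cell J hJc.1]
    rw [T.card_cell K hKc.1] at hlt
    omega
  rw [← Finset.coe_inter, ← hinter] at hmem
  exact h2 hmem

theorem outwardNormal_eq_neg (hd : 0 < d) (hF : F.card = d) (hK : K ∈ T.cellsAt F)
    (hJ : J ∈ T.cellsAt F) (h : K ≠ J) : outwardNormal J F = -outwardNormal K F :=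
  (outwardNormal_eq_or_eq_neg hd hF hK hJ).resolve_left fun h' =>
    h (eq_of_outwardNormal_eq hd hF hK hJ h'.symm)

theorem card_cellsAt_le_two (hd : 0 < d) (hF : F.card = d) : (T.cellsAt F).card ≤ 2 := by
  by_contra! h
  obtain ⟨K, hK, J, hJ, L, hL, hKJ, hKL, hJL⟩ := Finset.two_lt_card.1 h
  refine hJL (eq_of_outwardNormal_eq hd hF hJ hL ?_)
  rw [outwardNormal_eq_neg hd hF hK hJ hKJ, outwardNormal_eq_neg hd hF hK hL hKL]

/-- If a point of the face were interior to `Ω`, so would be a nearby point `y` in the relative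
interior of the face. By conformity, an element containing `y` contains all vertices of the face, so
it is `K`. The closed elements cover `closure Ω`, so `K` would be a neighbourhood of `y`, which a
small step along the outward normal contradicts. -/
theorem subset_frontier_of_cellsAt_eq_singleton (hd : 0 < d) (hF : F.card = d)
    (hFK : T.cellsAt F = {K}) : convexHull ℝ (F : Set (E d)) ⊆ frontier Ω := by
  have hK : K ∈ T.cellsAt F := by rw [hFK]; exact Finset.mem_singleton_self K
  have huniq : ∀ J ∈ T.cells, F ⊆ J → J = K := fun J hJ hJF =>
    Finset.mem_singleton.1 (hFK ▸ mem_cellsAt.2 ⟨hJ, hJF⟩)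
  obtain ⟨i, rfl⟩ := exists_eq_erase hF hK
  have hKc := (mem_cellsAt.1 hK).1
  obtain ⟨hn, c, hc, hnc⟩ :=
    outwardNormal_spec (T.card_cell K hKc) (T.affineIndependent_cell K hKc) hd i
  have hcellK := convexHull_cell (T.card_cell K hKc) (T.affineIndependent_cell K hKc)
  have hface := convexHull_erase (T.card_cell K hKc) (T.affineIndependent_cell K hKc) i
  have hzero := fun (s : Set (E d)) (hs : s ⊆ K) =>
    coord_eq_zero_of_mem_convexHull (T.card_cell K hKc) (T.affineIndependent_cell K hKc) hs
  set b := simplexBasis (T.card_cell K hKc) (T.affineIndependent_cell K hKc) with hb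
  set n := outwardNormal K (K.erase (i : E d))
  have hne : (K.erase (i : E d)).Nonempty := by rw [← Finset.card_pos, hF]; exact hd
  have hcen := coord_centroid (T.card_cell K hKc) (T.affineIndependent_cell K hKc) hne
    (Finset.erase_subset _ _)
  rw [← hb] at hcen
  set z := (K.erase (i : E d)).centroid ℝ id
  intro x hx
  rw [hface] at hx
  have hcov : ∀ y ∈ convexHull ℝ (K : Set (E d)), y ∈ closure Ω := fun y hy => by
    rw [← T.covers]; exact Set.mem_biUnion hKc hy
  refine ⟨hcov x (hcellK ▸ hx.1), fun hxint => ?_⟩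
  have hO : IsOpen (interior Ω) := isOpen_interior
  -- Moving from `x` towards the barycentre of the face makes every barycentric coordinate except
  -- the `i`-th strictly positive.
  obtain ⟨s, hsO, hs0, hs1⟩ : ∃ s : ℝ, x + s • (z - x) ∈ interior Ω ∧ 0 < s ∧ s < 1 := by
    have hcont : Tendsto (fun s : ℝ => x + s • (z - x)) (𝓝[>] 0) (𝓝 (x + (0 : ℝ) • (z - x))) :=
      (Continuous.tendsto (by fun_prop) 0).mono_left nhdsWithin_le_nhds
    rw [zero_smul, add_zero] at hcont
    exact ((hcont.eventually (hO.mem_nhds hxint)).and (Ioo_mem_nhdsGT one_pos)).exists.imp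
      fun s hs => ⟨hs.1, hs.2.1, hs.2.2⟩
  set y := x + s • (z - x) with hy
  have hcoord : ∀ k, b.coord k y = (1 - s) * b.coord k x + s * b.coord k z := by
    intro k
    rw [hy, coord_add, map_smul, coord_linear_sub, smul_eq_mul]; ring
  have hyi : b.coord i y = 0 := by
    rw [hcoord, hx.2, hcen]; simp
  have hypos : ∀ k : K, k ≠ i → 0 < b.coord k y := by
    intro k hki
    have hz : 0 < b.coord k z := by
      rw [hcen, if_pos (Finset.mem_erase.2 ⟨fun h => hki (Subtype.ext h), k.2⟩), hF]
      positivity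
    rw [hcoord]
    have := mul_nonneg (sub_nonneg.2 hs1.le) (hx.1 k)
    have := mul_pos hs0 hz
    linarith
  have hyK : y ∈ convexHull ℝ (K : Set (E d)) := by
    rw [hcellK]
    intro k
    by_cases hki : k = i
    · rw [hki, hyi]
    · exact (hypos k hki).le
  have honly : ∀ J ∈ T.cells, y ∈ convexHull ℝ (J : Set (E d)) → J = K := by
    intro J hJ hyJ
    refine huniq J hJ fun k hk => ?_
    obtain ⟨hki, hkK⟩ := Finset.mem_erase.1 hk
    by_contra hkJ
    have hmem := (T.conforming K hKc J hJ).subset ⟨hyK, hyJ⟩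
    have h0 := hzero _ Set.inter_subset_left ⟨k, hkK⟩ (fun h => hkJ h.2) hmem
    exact (hypos ⟨k, hkK⟩ fun h => hki (congrArg Subtype.val h)).ne' h0
  have hnear : ∀ᶠ p in 𝓝 y, p ∈ convexHull ℝ (K : Set (E d)) := by
    have hall : ∀ᶠ p in 𝓝 y, ∀ J ∈ T.cells, p ∈ convexHull ℝ (J : Set (E d)) → J = K := by
      rw [Filter.eventually_all_finset]
      intro J hJ
      by_cases hyJ : y ∈ convexHull ℝ (J : Set (E d))
      · exact Eventually.of_forall fun _ _ => honly J hJ hyJ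
      · have hcl : IsClosed (convexHull ℝ (J : Set (E d))) :=
          (J.finite_toSet.isCompact_convexHull ℝ).isClosed
        filter_upwards [hcl.isOpen_compl.mem_nhds hyJ] with p hp h using absurd h hp
    filter_upwards [hall, hO.mem_nhds hsO] with p hp hpO
    have hpc : p ∈ closure Ω := subset_closure (interior_subset hpO)
    rw [← T.covers] at hpc
    obtain ⟨J, hJ, hpJ⟩ := Set.mem_iUnion₂.1 hpc
    rw [← hp J hJ hpJ]; exact hpJ
  have hcont : Tendsto (fun t : ℝ => y + t • n) (𝓝[>] 0) (𝓝 (y + (0 : ℝ) • n)) :=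
    (Continuous.tendsto (by fun_prop) 0).mono_left nhdsWithin_le_nhds
  rw [zero_smul, add_zero] at hcont
  obtain ⟨t, htK, ht0⟩ := ((hcont.eventually hnear).and self_mem_nhdsWithin).exists
  rw [hcellK] at htK
  have h1 := htK i
  have h2 : 0 < t := ht0
  have h3 := hnc n
  rw [real_inner_self_eq_norm_sq, hn] at h3
  rw [coord_add, map_smul, hyi, smul_eq_mul, zero_add] at h1
  have h4 : 0 ≤ (b.coord i).linear n := nonneg_of_mul_nonneg_right h1 h2
  nlinarith

theorem mem_boundaryFaces_of_card_ne_two (hd : 0 < d) (hF : F ∈ T.faces)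
    (h : (T.cellsAt F).card ≠ 2) : F ∈ T.boundaryFaces := by
  have hcard := card_of_mem_faces hF
  have hpos : 0 < (T.cellsAt F).card := by
    obtain ⟨K, hK, hFK⟩ := Finset.mem_biUnion.1 hF
    exact Finset.card_pos.2 ⟨K, mem_cellsAt.2 ⟨hK, (Finset.mem_powersetCard.1 hFK).1⟩⟩
  have hle := card_cellsAt_le_two (T := T) hd hcard
  obtain ⟨K, hK⟩ := Finset.card_eq_one.1 (by omega : (T.cellsAt F).card = 1)
  exact Finset.mem_filter.2 ⟨hF, subset_frontier_of_cellsAt_eq_singleton hd hcard hK⟩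

theorem exists_cellsAt_eq_pair (hd : 0 < d) (hF : F ∈ T.interiorFaces) :
    ∃ K J, K ∈ T.cells ∧ J ∈ T.cells ∧ K ≠ J ∧ T.cellsAt F = {K, J} ∧
      outwardNormal J F = -outwardNormal K F := by
  obtain ⟨hFf, h2⟩ := Finset.mem_filter.1 hF
  obtain ⟨K, J, hne, hKJ⟩ := Finset.card_eq_two.1 h2
  have hK : K ∈ T.cellsAt F := by simp [hKJ]
  have hJ : J ∈ T.cellsAt F := by simp [hKJ]
  exact ⟨K, J, (mem_cellsAt.1 hK).1, (mem_cellsAt.1 hJ).1, hne, hKJ,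
    outwardNormal_eq_neg hd (card_of_mem_faces hFf) hK hJ hne⟩

theorem integrableOn_face (hd : 0 < d) (hF : F ∈ T.faces) {g : E d → ℝ} (hg : Continuous g) :
    IntegrableOn g (convexHull ℝ (F : Set (E d))) μHE[d - 1] := by
  have hcard := card_of_mem_faces hF
  have hcomp : IsCompact (convexHull ℝ (F : Set (E d))) := F.finite_toSet.isCompact_convexHull ℝ
  obtain ⟨K, hKc, hFK⟩ := Finset.mem_biUnion.1 hF
  have hK : K ∈ T.cellsAt F := mem_cellsAt.2 ⟨hKc, (Finset.mem_powersetCard.1 hFK).1⟩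
  obtain ⟨p, hp⟩ : F.Nonempty := by rw [← Finset.card_pos, hcard]; exact hd
  refine hg.continuousOn.integrableOn_of_subset_isCompact hcomp hcomp.measurableSet subset_rfl
    (hausdorff_hyperplane_lt_top (outwardNormal K F) p (norm_outwardNormal hd hcard hK)
      hcomp fun x hx => ?_).ne
  refine (inner_outwardNormal_eq_zero_iff hd hcard hK _).2 ?_
  rw [← direction_affineSpan]
  exact AffineSubspace.vsub_mem_direction (convexHull_subset_affineSpan _ hx)
    (subset_affineSpan ℝ _ hp)

/-- Pairs of an element and an opposite vertex correspond to pairs of a face and an element adjacent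
to it. -/
theorem sum_cells_eq_sum_faces (G : Finset (E d) → Finset (E d) → ℝ) :
    ∑ K ∈ T.cells, ∑ i : K, G K (K.erase i) = ∑ F ∈ T.faces, ∑ K ∈ T.cellsAt F, G K F := by
  have h1 : ∀ K ∈ T.cells, ∑ i : K, G K (K.erase i) = ∑ F ∈ K.powersetCard d, G K F := by
    intro K hK
    rw [Finset.sum_coe_sort K (fun i => G K (K.erase i))]
    refine Finset.sum_bij (fun i _ => K.erase i) (fun i hi => ?_) (fun i hi j hj h => ?_)
      (fun F hF => ?_) (fun i _ => rfl)
    · rw [Finset.mem_powersetCard, Finset.card_erase_of_mem hi, T.card_cell K hK]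
      exact ⟨Finset.erase_subset _ _, rfl⟩
    · exact Finset.erase_injOn K hi hj h
    · obtain ⟨hFK, hcard⟩ := Finset.mem_powersetCard.1 hF
      obtain ⟨i, hi⟩ := exists_eq_erase hcard (mem_cellsAt.2 ⟨hK, hFK⟩)
      exact ⟨i, i.2, hi.symm⟩
  rw [Finset.sum_congr rfl h1]
  refine Finset.sum_comm' fun K F => ?_
  rw [mem_cellsAt, Finset.mem_powersetCard]
  constructor
  · rintro ⟨hK, hFK, hc⟩
    exact ⟨⟨hK, hFK⟩, Finset.mem_biUnion.2 ⟨K, hK, Finset.mem_powersetCard.2 ⟨hFK, hc⟩⟩⟩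
  · rintro ⟨⟨hK, hFK⟩, hF⟩
    exact ⟨hK, hFK, card_of_mem_faces hF⟩

end Faces

end Triangulation

end DGScheme

namespace DGScheme

namespace Triangulation

section Calculus

variable {d : ℕ} {Ω : Set (E d)} {M : Type} [NormedAddCommGroup M] [NormedSpace ℝ M]

/-! ### Elementwise regular functions -/

/-- `u` is continuous on each element. -/
def Cts (T : Triangulation d Ω) (u : Broken d M) : Prop := ∀ K ∈ T.cells, Continuous (u K)

/-- `u` is continuously differentiable on each element. -/
def Smooth (T : Triangulation d Ω) (u : Broken d M) : Prop := ∀ K ∈ T.cells, ContDiff ℝ 1 (u K)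

variable {T : Triangulation d Ω} {u u' : Broken d ℝ} {w w' : Broken d (E d)}

theorem Smooth.cts {f : Broken d M} (h : T.Smooth f) : T.Cts f := fun K hK => (h K hK).continuous

omit [NormedSpace ℝ M] in
theorem Cts.add {f g : Broken d M} (hf : T.Cts f) (hg : T.Cts g) :
    T.Cts fun K x => f K x + g K x :=
  fun K hK => (hf K hK).add (hg K hK)

omit [NormedSpace ℝ M] in
theorem Cts.sub {f g : Broken d M} (hf : T.Cts f) (hg : T.Cts g) :
    T.Cts fun K x => f K x - g K x :=
  fun K hK => (hf K hK).sub (hg K hK)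

theorem Cts.mul (hf : T.Cts u) (hg : T.Cts u') : T.Cts fun K x => u K x * u' K x :=
  fun K hK => (hf K hK).mul (hg K hK)

theorem Cts.const_mul (hf : T.Cts u) (c : ℝ) : T.Cts fun K x => c * u K x :=
  fun K hK => continuous_const.mul (hf K hK)

theorem Cts.inner (hf : T.Cts w) (hg : T.Cts w') : T.Cts fun K x => ⟪w K x, w' K x⟫ :=
  fun K hK => (hf K hK).inner (hg K hK)

theorem Cts.comp {g : ℝ → ℝ} (hg : Continuous g) (hu : T.Cts u) : T.Cts fun K x => g (u K x) :=
  fun K hK => hg.comp (hu K hK)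

theorem Smooth.add {f g : Broken d M} (hf : T.Smooth f) (hg : T.Smooth g) :
    T.Smooth fun K x => f K x + g K x :=
  fun K hK => (hf K hK).add (hg K hK)

theorem Smooth.sub {f g : Broken d M} (hf : T.Smooth f) (hg : T.Smooth g) :
    T.Smooth fun K x => f K x - g K x :=
  fun K hK => (hf K hK).sub (hg K hK)

theorem Smooth.const_mul (hf : T.Smooth u) (c : ℝ) : T.Smooth fun K x => c * u K x :=
  fun K hK => contDiff_const.mul (hf K hK)

theorem Smooth.const_smul {f : Broken d M} (hf : T.Smooth f) (c : ℝ) :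
    T.Smooth fun K x => c • f K x :=
  fun K hK => contDiff_const.smul (hf K hK)

theorem Smooth.smul {f : Broken d M} (hu : T.Smooth u) (hf : T.Smooth f) :
    T.Smooth fun K x => u K x • f K x :=
  fun K hK => (hu K hK).smul (hf K hK)

theorem inner_grad (u : Broken d ℝ) (K : Finset (E d)) (x y : E d) :
    ⟪grad u K x, y⟫ = fderiv ℝ (u K) x y := by
  rw [grad, gradient, InnerProductSpace.toDual_symm_apply]

theorem Smooth.cts_grad (hu : T.Smooth u) : T.Cts (grad u) := fun K hK =>
  (InnerProductSpace.toDual ℝ (E d)).symm.continuous.comp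
    ((hu K hK).continuous_fderiv one_ne_zero)

theorem Smooth.cts_dvg (hw : T.Smooth w) : T.Cts (dvg w) := fun K hK =>
  continuous_finsetSum _ fun i _ =>
    (EuclideanSpace.proj (𝕜 := ℝ) i).continuous.comp
      (((hw K hK).continuous_fderiv one_ne_zero).clm_apply continuous_const)

/-! ### Linearity of the integrals -/

theorem integral_congr {u u' : Broken d ℝ} (h : ∀ K ∈ T.cells, ∀ x, u K x = u' K x) :
    T.integral u = T.integral u' :=
  Finset.sum_congr rfl fun K hK => by simp_rw [h K hK]

theorem Cts.integrableOn (hu : T.Cts u) {K : Finset (E d)} (hK : K ∈ T.cells) :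
    IntegrableOn (u K) (convexHull ℝ (K : Set (E d))) :=
  (hu K hK).continuousOn.integrableOn_compact (K.finite_toSet.isCompact_convexHull ℝ)

theorem integral_add (hu : T.Cts u) (hu' : T.Cts u') :
    T.integral (fun K x => u K x + u' K x) = T.integral u + T.integral u' := by
  simp only [integral]
  rw [← Finset.sum_add_distrib]
  exact Finset.sum_congr rfl fun K hK =>
    MeasureTheory.integral_add (hu.integrableOn hK) (hu'.integrableOn hK)

theorem integral_const_mul (c : ℝ) (u : Broken d ℝ) :
    T.integral (fun K x => c * u K x) = c * T.integral u := by
  simp only [integral]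
  rw [Finset.mul_sum]
  exact Finset.sum_congr rfl fun K _ => MeasureTheory.integral_const_mul _ _

theorem integral_sub (hu : T.Cts u) (hu' : T.Cts u') :
    T.integral (fun K x => u K x - u' K x) = T.integral u - T.integral u' := by
  simp only [integral]
  rw [← Finset.sum_sub_distrib]
  exact Finset.sum_congr rfl fun K hK =>
    MeasureTheory.integral_sub (hu.integrableOn hK) (hu'.integrableOn hK)

theorem interiorFaces_subset : T.interiorFaces ⊆ T.faces := Finset.filter_subset _ _

theorem faceIntegral_congr {S : Finset (Finset (E d))} {g g' : Finset (E d) → E d → ℝ}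
    (h : ∀ F ∈ S, ∀ x, g F x = g' F x) : faceIntegral S g = faceIntegral S g' :=
  Finset.sum_congr rfl fun F hF => by simp_rw [h F hF]

theorem faceIntegral_const_mul (S : Finset (Finset (E d))) (c : ℝ)
    (g : Finset (E d) → E d → ℝ) :
    faceIntegral S (fun F x => c * g F x) = c * faceIntegral S g := by
  simp only [faceIntegral]
  rw [Finset.mul_sum]
  exact Finset.sum_congr rfl fun F _ => MeasureTheory.integral_const_mul _ _

theorem faceIntegral_add (hd : 0 < d) {g g' : Finset (E d) → E d → ℝ}
    (hg : ∀ F, Continuous (g F)) (hg' : ∀ F, Continuous (g' F)) :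
    faceIntegral T.interiorFaces (fun F x => g F x + g' F x) =
      faceIntegral T.interiorFaces g + faceIntegral T.interiorFaces g' := by
  simp only [faceIntegral]
  rw [← Finset.sum_add_distrib]
  exact Finset.sum_congr rfl fun F hF => MeasureTheory.integral_add
    (integrableOn_face hd (interiorFaces_subset hF) (hg F))
    (integrableOn_face hd (interiorFaces_subset hF) (hg' F))

theorem faceIntegral_sub (hd : 0 < d) {g g' : Finset (E d) → E d → ℝ}
    (hg : ∀ F, Continuous (g F)) (hg' : ∀ F, Continuous (g' F)) :
    faceIntegral T.interiorFaces (fun F x => g F x - g' F x) =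
      faceIntegral T.interiorFaces g - faceIntegral T.interiorFaces g' := by
  simp only [faceIntegral]
  rw [← Finset.sum_sub_distrib]
  exact Finset.sum_congr rfl fun F hF => MeasureTheory.integral_sub
    (integrableOn_face hd (interiorFaces_subset hF) (hg F))
    (integrableOn_face hd (interiorFaces_subset hF) (hg' F))

theorem Cts.continuous_avg {f : Broken d M} (hf : T.Cts f) (F : Finset (E d)) :
    Continuous (T.avg f F) :=
  continuous_const.smul (continuous_finsetSum _ fun K hK => hf K (mem_cellsAt.1 hK).1)

theorem Cts.continuous_jump (hu : T.Cts u) (F : Finset (E d)) : Continuous (T.jump u F) :=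
  continuous_finsetSum _ fun K hK => (hu K (mem_cellsAt.1 hK).1).smul continuous_const

theorem Cts.continuous_vjump (hw : T.Cts w) (F : Finset (E d)) : Continuous (T.vjump w F) :=
  continuous_finsetSum _ fun K hK => (hw K (mem_cellsAt.1 hK).1).inner continuous_const

/-! ### Integration by parts -/

theorem integral_dvg (hd : 0 < d) (hw : T.Smooth w) :
    T.integral (dvg w) = ∑ F ∈ T.faces, ∑ K ∈ T.cellsAt F,
      ∫ x in convexHull ℝ (F : Set (E d)), ⟪w K x, outwardNormal K F⟫ ∂μHE[d - 1] := by
  classical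
  rw [← sum_cells_eq_sum_faces (fun K F =>
    ∫ x in convexHull ℝ (F : Set (E d)), ⟪w K x, outwardNormal K F⟫ ∂μHE[d - 1])]
  refine Finset.sum_congr rfl fun K hK => ?_
  have hcomp : ∀ i, ContDiff ℝ 1 fun x => w K x i := fun i =>
    (contDiff_euclidean.1 (hw K hK)) i
  have hfd : ∀ i x y, fderiv ℝ (fun x => w K x i) x y = fderiv ℝ (w K) x y i := by
    intro i x y
    have h1 := ((hw K hK).differentiable one_ne_zero).differentiableAt (x := x) |>.hasFDerivAt
    have h2 := (EuclideanSpace.proj (𝕜 := ℝ) i).hasFDerivAt.comp x h1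
    have h3 : HasFDerivAt (fun x => w K x i) _ x := h2
    rw [h3.fderiv]
    rfl
  simp only [dvg, ← hfd]
  rw [integral_finsetSum]
  · simp_rw [integral_simplex_fderiv (T.card_cell K hK) (T.affineIndependent_cell K hK) hd
      (hcomp _)]
    rw [Finset.sum_comm]
    refine Finset.sum_congr rfl fun i _ => ?_
    have hF : K.erase (i : E d) ∈ T.faces := by
      refine Finset.mem_biUnion.2 ⟨K, hK, Finset.mem_powersetCard.2 ⟨Finset.erase_subset _ _, ?_⟩⟩
      rw [Finset.card_erase_of_mem i.2, T.card_cell K hK]; rfl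
    simp_rw [← MeasureTheory.integral_const_mul]
    rw [← integral_finsetSum]
    · refine setIntegral_congr_fun
        ((K.erase (i : E d)).finite_toSet.isCompact_convexHull ℝ).measurableSet fun x _ => ?_
      simp [PiLp.inner_apply]
    · intro j _
      exact integrableOn_face hd hF (continuous_const.mul (hcomp j).continuous)
  · intro i _
    exact (((hcomp i).continuous_fderiv one_ne_zero).clm_apply
      continuous_const).continuousOn.integrableOn_compact (K.finite_toSet.isCompact_convexHull ℝ)

theorem dvg_smul (hu : T.Smooth u) (hw : T.Smooth w) {K : Finset (E d)} (hK : K ∈ T.cells)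
    (x : E d) : dvg (fun K x => u K x • w K x) K x =
      ⟪grad u K x, w K x⟫ + u K x * dvg w K x := by
  have h1 := ((hu K hK).differentiable one_ne_zero).differentiableAt (x := x)
  have h2 := ((hw K hK).differentiable one_ne_zero).differentiableAt (x := x)
  rw [inner_grad]
  simp only [dvg]
  rw [fderiv_fun_smul h1 h2]
  simp only [_root_.add_apply, _root_.smul_apply,
    ContinuousLinearMap.smulRight_apply, PiLp.add_apply, PiLp.smul_apply, smul_eq_mul]
  rw [Finset.sum_add_distrib, ← Finset.mul_sum, add_comm]
  congr 1
  have hx : w K x = ∑ i, w K x i • EuclideanSpace.single i (1 : ℝ) := by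
    ext j; simp [Pi.single_apply]
  conv_rhs => rw [hx]
  rw [map_sum]
  simp only [map_smul, smul_eq_mul]
  exact Finset.sum_congr rfl fun i _ => mul_comm _ _

/-- The mixed products of a trace from `K` with a trace from `J` cancel because the normals are
opposite. -/
theorem sum_pair_jump (u : Broken d ℝ) (w : Broken d (E d)) {F K J : Finset (E d)} (hKJ : K ≠ J)
    (hF : T.cellsAt F = {K, J}) (hn : outwardNormal J F = -outwardNormal K F) (x : E d) :
    ⟪T.jump u F x, T.avg w F x⟫ + T.vjump w F x * T.avg u F x =
      ∑ L ∈ T.cellsAt F, u L x * ⟪w L x, outwardNormal L F⟫ := by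
  classical
  simp only [jump, vjump, avg, hF, Finset.sum_pair hKJ, Finset.card_pair hKJ, hn, inner_neg_right,
    inner_add_left, inner_add_right, inner_smul_left, inner_smul_right, conj_trivial, smul_eq_mul,
    inner_neg_left, smul_neg]
  rw [real_inner_comm (w K x), real_inner_comm (w J x)]
  push_cast
  ring

/-- Integration by parts on all elements. -/
theorem integral_by_parts (hd : 0 < d) (hu : T.Smooth u) (hw : T.Smooth w)
    (hbd : ∀ F ∈ T.boundaryFaces, ∀ K ∈ T.cellsAt F, ∀ x ∈ convexHull ℝ (F : Set (E d)),
      u K x * ⟪w K x, outwardNormal K F⟫ = 0) :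
    T.integral (fun K x => ⟪grad u K x, w K x⟫) + T.integral (fun K x => u K x * dvg w K x) =
      faceIntegral T.interiorFaces (fun F x => ⟪T.jump u F x, T.avg w F x⟫)
      + faceIntegral T.interiorFaces (fun F x => T.vjump w F x * T.avg u F x) := by
  classical
  rw [← integral_add (hu.cts_grad.inner hw.cts) (hu.cts.mul hw.cts_dvg),
    ← faceIntegral_add hd (g := fun F x => ⟪T.jump u F x, T.avg w F x⟫)
      (g' := fun F x => T.vjump w F x * T.avg u F x)
      (fun F => (hu.cts.continuous_jump F).inner (hw.cts.continuous_avg F))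
      (fun F => (hw.cts.continuous_vjump F).mul (hu.cts.continuous_avg F)),
    integral_congr fun K hK x => (dvg_smul hu hw hK x).symm]
  refine (integral_dvg hd (hu.smul hw)).trans ?_
  rw [faceIntegral]
  symm
  -- A face that is not interior lies on `∂Ω`, where `hbd` makes the integrand vanish.
  refine Finset.sum_subset_zero_on_sdiff interiorFaces_subset (fun F hF => ?_) (fun F hF => ?_)
  · obtain ⟨hFf, hFi⟩ := Finset.mem_sdiff.1 hF
    have hFb : F ∈ T.boundaryFaces := mem_boundaryFaces_of_card_ne_two hd hFf fun h =>
      hFi (Finset.mem_filter.2 ⟨hFf, h⟩)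
    refine Finset.sum_eq_zero fun K hK => ?_
    refine setIntegral_eq_zero_of_forall_eq_zero fun x hx => ?_
    rw [inner_smul_left]
    exact hbd F hFb K hK x hx
  · obtain ⟨K, J, -, -, hKJ, hpair, hn⟩ := exists_cellsAt_eq_pair hd hF
    rw [← integral_finsetSum]
    · refine setIntegral_congr_fun (F.finite_toSet.isCompact_convexHull ℝ).measurableSet
        fun x _ => ?_
      simp only [inner_smul_left, conj_trivial]
      exact sum_pair_jump u w hKJ hpair hn x
    · intro L hL
      exact integrableOn_face hd (interiorFaces_subset hF)
        (((hu.smul hw).cts L (mem_cellsAt.1 hL).1).inner continuous_const)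

/-- The discrete convection terms cancel on the interior faces. -/
theorem frob_convection (hd : 0 < d) (v z : Broken d (E d)) {F : Finset (E d)}
    (hF : F ∈ T.interiorFaces) (x : E d) :
    frob (outer (T.avg v F x) (T.avg z F x)) (T.tjump v F x) =
      1 / 2 * ⟪T.jump (fun K x => ‖v K x‖ ^ 2) F x, T.avg z F x⟫ := by
  classical
  obtain ⟨K, J, -, -, hKJ, hpair, hn⟩ := exists_cellsAt_eq_pair hd hF
  have hfrob : ∀ p q y n : E d, frob (outer p q) (outer y n) = ⟪p, y⟫ * ⟪q, n⟫ := by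
    intro p q y n
    simp only [frob, outer, Matrix.of_apply, PiLp.inner_apply, Finset.sum_mul_sum]
    refine Finset.sum_congr rfl fun i _ => Finset.sum_congr rfl fun j _ => ?_
    simp; ring
  have hadd : ∀ A B C : Matrix (Fin d) (Fin d) ℝ, frob A (B + C) = frob A B + frob A C := by
    intro A B C
    simp only [frob, Matrix.add_apply, mul_add, Finset.sum_add_distrib]
  simp only [tjump, jump, hpair, Finset.sum_pair hKJ, hn]
  rw [hadd, hfrob, hfrob]
  -- With this average, `{v}·(v_K - v_J) = ½ (|v_K|² - |v_J|²)`, which is the jump of `½|v|²` along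
  -- the normal of `K`.
  have havg : T.avg v F x = (2⁻¹ : ℝ) • (v K x + v J x) := by
    simp [avg, hpair, Finset.sum_pair hKJ, Finset.card_pair hKJ]
  rw [havg, inner_neg_right, inner_add_left, inner_smul_left, inner_smul_left, inner_smul_left,
    inner_smul_left, inner_neg_left, inner_add_left, inner_add_left, real_inner_self_eq_norm_sq,
    real_inner_self_eq_norm_sq, real_inner_comm (v K x) (v J x),
    real_inner_comm (T.avg z F x) (outwardNormal K F)]
  simp only [conj_trivial]
  ring

theorem inner_convect {v : Broken d (E d)} (hv : T.Smooth v) {K : Finset (E d)} (hK : K ∈ T.cells)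
    (x : E d) :
    ⟪convect v K x, v K x⟫ = 1 / 2 * ⟪grad (fun K x => ‖v K x‖ ^ 2) K x, v K x⟫ := by
  have h := ((hv K hK).differentiable one_ne_zero).differentiableAt (x := x) |>.hasFDerivAt
  rw [inner_grad, h.norm_sq.fderiv, convect]
  simp [real_inner_comm]

end Calculus

end Triangulation

end DGScheme

namespace DGScheme

namespace Triangulation

section Spaces

variable {d : ℕ} {Ω : Set (E d)} {T : Triangulation d Ω} {p : ℕ}

/-! ### Finite element functions -/

theorem MemV.add {u w : Broken d ℝ} (hu : T.MemV p u) (hw : T.MemV p w) :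
    T.MemV p fun K x => u K x + w K x := by
  intro K hK
  obtain ⟨P, hP, hPu⟩ := hu K hK
  obtain ⟨Q, hQ, hQw⟩ := hw K hK
  exact ⟨P + Q, (MvPolynomial.totalDegree_add P Q).trans (max_le hP hQ), fun x => by
    simp only [hPu, hQw, map_add]⟩

theorem MemV.const_mul {u : Broken d ℝ} (hu : T.MemV p u) (c : ℝ) :
    T.MemV p fun K x => c * u K x := by
  intro K hK
  obtain ⟨P, hP, hPu⟩ := hu K hK
  exact ⟨c • P, (MvPolynomial.totalDegree_smul_le c P).trans hP, fun x => by
    simp only [hPu, MvPolynomial.smul_eval]⟩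

theorem MemV.sub {u w : Broken d ℝ} (hu : T.MemV p u) (hw : T.MemV p w) :
    T.MemV p fun K x => u K x - w K x := by
  intro K hK
  obtain ⟨P, hP, hPu⟩ := hu.add (hw.const_mul (-1)) K hK
  exact ⟨P, hP, fun x => by rw [← hPu]; ring⟩

/-- `Smooth` asks for regularity on all of `ℝ^d`; polynomial pieces have it, so no one-sided
derivatives arise at element boundaries. -/
theorem MemV.smooth {u : Broken d ℝ} (hu : T.MemV p u) : T.Smooth u := by
  intro K hK
  obtain ⟨P, -, hPu⟩ := hu K hK
  rw [show u K = fun x => MvPolynomial.eval (fun i => x i) P from funext hPu]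
  simp only [MvPolynomial.eval_eq]
  refine ContDiff.sum fun s _ => contDiff_const.mul (contDiff_prod fun i _ => ContDiff.pow ?_ _)
  exact (EuclideanSpace.proj (𝕜 := ℝ) i).contDiff

theorem smooth_of_components {w : Broken d (E d)} (hw : ∀ i, T.MemV p fun K x => w K x i) :
    T.Smooth w :=
  fun K hK => contDiff_euclidean.2 fun i => (hw i).smooth K hK

theorem MemV0d.smooth {v : Broken d (E d)} (hv : T.MemV0d p v) : T.Smooth v :=
  smooth_of_components fun i => (hv i).1

theorem MemVn.smooth {q : Broken d (E d)} (hq : T.MemVn p q) : T.Smooth q :=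
  smooth_of_components hq.1

theorem MemV0d.eq_zero {v : Broken d (E d)} (hv : T.MemV0d p v) {F K : Finset (E d)}
    (hF : F ∈ T.boundaryFaces) (hK : K ∈ T.cellsAt F) {x : E d}
    (hx : x ∈ convexHull ℝ (F : Set (E d))) : v K x = 0 := by
  ext i
  exact (hv i).2 F hF K hK x hx

theorem MemV0d.mid {v w : Broken d (E d)} (hv : T.MemV0d p v) (hw : T.MemV0d p w) :
    T.MemV0d p fun K x => (1 / 2 : ℝ) • (v K x + w K x) := fun i =>
  ⟨((hv i).1.add (hw i).1).const_mul (1 / 2), fun F hF K hK x hx => by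
    simp [hv.eq_zero hF hK hx, hw.eq_zero hF hK hx]⟩

theorem MemVn.mid {v w : Broken d (E d)} (hv : T.MemVn p v) (hw : T.MemVn p w) :
    T.MemVn p fun K x => (1 / 2 : ℝ) • (v K x + w K x) :=
  ⟨fun i => ((hv.1 i).add (hw.1 i)).const_mul (1 / 2), fun F hF K hK x hx => by
    rw [inner_smul_left, inner_add_left, hv.2 F hF K hK x hx, hw.2 F hF K hK x hx]; simp⟩

end Spaces

/-! ### Linearity of gradients, jumps and averages -/

section Linear

variable {d : ℕ} {Ω : Set (E d)} {T : Triangulation d Ω}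

theorem grad_sub {u w : Broken d ℝ} (hu : T.Smooth u) (hw : T.Smooth w) {K : Finset (E d)}
    (hK : K ∈ T.cells) (x : E d) :
    grad (fun K x => u K x - w K x) K x = grad u K x - grad w K x := by
  refine ext_inner_right ℝ fun y => ?_
  rw [inner_sub_left, inner_grad, inner_grad, inner_grad,
    fderiv_fun_sub ((hu K hK).differentiable one_ne_zero x)
      ((hw K hK).differentiable one_ne_zero x)]
  rfl

theorem grad_mid {u w : Broken d ℝ} (hu : T.Smooth u) (hw : T.Smooth w) {K : Finset (E d)}
    (hK : K ∈ T.cells) (x : E d) :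
    grad (fun K x => (1 / 2 : ℝ) * (u K x + w K x)) K x =
      (1 / 2 : ℝ) • (grad u K x + grad w K x) := by
  have h1 := (hu K hK).differentiable one_ne_zero x
  have h2 := (hw K hK).differentiable one_ne_zero x
  refine ext_inner_right ℝ fun y => ?_
  rw [inner_smul_left, inner_add_left, inner_grad, inner_grad, inner_grad,
    fderiv_const_mul (h1.fun_add h2), fderiv_fun_add h1 h2]
  rfl

theorem jump_sub (u w : Broken d ℝ) (F : Finset (E d)) (x : E d) :
    T.jump (fun K x => u K x - w K x) F x = T.jump u F x - T.jump w F x := by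
  simp only [jump, sub_smul, Finset.sum_sub_distrib]

theorem jump_mid (u w : Broken d ℝ) (F : Finset (E d)) (x : E d) :
    T.jump (fun K x => (1 / 2 : ℝ) * (u K x + w K x)) F x =
      (1 / 2 : ℝ) • (T.jump u F x + T.jump w F x) := by
  simp only [jump, mul_smul, add_smul, ← Finset.smul_sum, Finset.sum_add_distrib]

theorem avg_sub_const_mul (u w : Broken d ℝ) (c : ℝ) (F : Finset (E d)) (x : E d) :
    T.avg (fun K x => u K x - c * w K x) F x = T.avg u F x - c * T.avg w F x := by
  simp only [avg, Finset.sum_sub_distrib, ← Finset.mul_sum, smul_eq_mul]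
  ring

theorem vjump_smul_sub (φ : Broken d ℝ) (v : Broken d (E d)) (c : ℝ) (F : Finset (E d)) (x : E d) :
    T.vjump (fun K x => (c * φ K x) • v K x - v K x) F x =
      c * T.vjump (fun K x => φ K x • v K x) F x - T.vjump v F x := by
  simp only [vjump, inner_sub_left, mul_smul, Finset.sum_sub_distrib, Finset.mul_sum]
  congr 1
  exact Finset.sum_congr rfl fun K _ => by rw [inner_smul_left]; rfl

end Linear

end Triangulation

namespace DGState

open Triangulation

variable {d : ℕ} {Ω : Set (E d)} {T : Triangulation d Ω} {p : ℕ}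

/-! ### The discrete gradient -/

theorem isDiscreteGradient_iff {φ : Broken d ℝ} {q : Broken d (E d)}
    (hφ : T.Smooth φ) (hq : T.Smooth q) :
    IsDiscreteGradient T p φ q ↔ ∀ τ, T.MemVn p τ →
      T.integral (fun K x => ⟪q K x, τ K x⟫) - T.integral (fun K x => ⟪grad φ K x, τ K x⟫)
        + faceIntegral T.interiorFaces (fun F x => ⟪T.jump φ F x, T.avg τ F x⟫) = 0 := by
  refine forall₂_congr fun τ hτ => ?_
  rw [integral_sub (hq.cts.inner hτ.smooth.cts) (hφ.cts_grad.inner hτ.smooth.cts), eq_comm]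

/-- The relation is linear in `(φ, q)`, so the new level is twice the midpoint minus the old level.
-/
theorem IsDiscreteGradient.next (hd : 0 < d) {φ φ' : Broken d ℝ} {q q' : Broken d (E d)}
    (hφ : T.Smooth φ) (hφ' : T.Smooth φ') (hq : T.Smooth q) (hq' : T.Smooth q')
    (h : IsDiscreteGradient T p φ q)
    (hmid : IsDiscreteGradient T p (fun K x => (1 / 2 : ℝ) * (φ K x + φ' K x))
      (fun K x => (1 / 2 : ℝ) • (q K x + q' K x))) :
    IsDiscreteGradient T p φ' q' := by
  rw [isDiscreteGradient_iff ((hφ.add hφ').const_mul _) ((hq.add hq').const_smul _)] at hmid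
  rw [isDiscreteGradient_iff hφ hq] at h
  rw [isDiscreteGradient_iff hφ' hq']
  intro τ hτ
  have h1 := h τ hτ
  have h2 := hmid τ hτ
  have hτc := hτ.smooth.cts
  have e1 : T.integral (fun K x => ⟪(1 / 2 : ℝ) • (q K x + q' K x), τ K x⟫) =
      1 / 2 * (T.integral (fun K x => ⟪q K x, τ K x⟫) +
        T.integral (fun K x => ⟪q' K x, τ K x⟫)) := by
    rw [← Triangulation.integral_add (hq.cts.inner hτc) (hq'.cts.inner hτc),
      ← Triangulation.integral_const_mul]
    exact integral_congr fun K _ x => by rw [inner_smul_left, inner_add_left]; rfl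
  have e2 : T.integral (fun K x =>
        ⟪grad (fun K x => (1 / 2 : ℝ) * (φ K x + φ' K x)) K x, τ K x⟫) =
      1 / 2 * (T.integral (fun K x => ⟪grad φ K x, τ K x⟫) +
        T.integral (fun K x => ⟪grad φ' K x, τ K x⟫)) := by
    rw [← Triangulation.integral_add (hφ.cts_grad.inner hτc) (hφ'.cts_grad.inner hτc),
      ← Triangulation.integral_const_mul]
    exact integral_congr fun K hK x => by
      rw [grad_mid hφ hφ' hK, inner_smul_left, inner_add_left]; rfl
  have e3 : faceIntegral T.interiorFaces (fun F x =>
        ⟪T.jump (fun K x => (1 / 2 : ℝ) * (φ K x + φ' K x)) F x, T.avg τ F x⟫) =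
      1 / 2 * (faceIntegral T.interiorFaces (fun F x => ⟪T.jump φ F x, T.avg τ F x⟫) +
        faceIntegral T.interiorFaces (fun F x => ⟪T.jump φ' F x, T.avg τ F x⟫)) := by
    rw [← faceIntegral_add hd
      (fun F => (hφ.cts.continuous_jump F).inner (hτc.continuous_avg F))
      (fun F => (hφ'.cts.continuous_jump F).inner (hτc.continuous_avg F)),
      ← faceIntegral_const_mul]
    exact faceIntegral_congr fun F _ x => by
      rw [jump_mid, inner_smul_left, inner_add_left]; rfl
  rw [e1, e2, e3] at h2
  linarith

theorem IsDiscreteGradient.sub (hd : 0 < d) {φ φ' : Broken d ℝ} {q q' : Broken d (E d)}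
    (hφ : T.Smooth φ) (hφ' : T.Smooth φ') (hq : T.Smooth q) (hq' : T.Smooth q')
    (h : IsDiscreteGradient T p φ q) (h' : IsDiscreteGradient T p φ' q') :
    IsDiscreteGradient T p (fun K x => φ' K x - φ K x) (fun K x => q' K x - q K x) := by
  rw [isDiscreteGradient_iff hφ hq] at h
  rw [isDiscreteGradient_iff hφ' hq'] at h'
  rw [isDiscreteGradient_iff (hφ'.sub hφ) (hq'.sub hq)]
  intro τ hτ
  have h1 := h τ hτ
  have h2 := h' τ hτ
  have hτc := hτ.smooth.cts
  have e1 : T.integral (fun K x => ⟪q' K x - q K x, τ K x⟫) =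
      T.integral (fun K x => ⟪q' K x, τ K x⟫) - T.integral (fun K x => ⟪q K x, τ K x⟫) := by
    rw [← Triangulation.integral_sub (hq'.cts.inner hτc) (hq.cts.inner hτc)]
    exact integral_congr fun K _ x => inner_sub_left _ _ _
  have e2 : T.integral (fun K x => ⟪grad (fun K x => φ' K x - φ K x) K x, τ K x⟫) =
      T.integral (fun K x => ⟪grad φ' K x, τ K x⟫) -
        T.integral (fun K x => ⟪grad φ K x, τ K x⟫) := by
    rw [← Triangulation.integral_sub (hφ'.cts_grad.inner hτc) (hφ.cts_grad.inner hτc)]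
    exact integral_congr fun K hK x => by rw [grad_sub hφ' hφ hK, inner_sub_left]
  have e3 : faceIntegral T.interiorFaces (fun F x =>
        ⟪T.jump (fun K x => φ' K x - φ K x) F x, T.avg τ F x⟫) =
      faceIntegral T.interiorFaces (fun F x => ⟪T.jump φ' F x, T.avg τ F x⟫) -
        faceIntegral T.interiorFaces (fun F x => ⟪T.jump φ F x, T.avg τ F x⟫) := by
    rw [← faceIntegral_sub hd
      (fun F => (hφ'.cts.continuous_jump F).inner (hτc.continuous_avg F))
      (fun F => (hφ.cts.continuous_jump F).inner (hτc.continuous_avg F))]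
    exact faceIntegral_congr fun F _ x => by rw [jump_sub, inner_sub_left]
  rw [e1, e2, e3]
  linarith

end DGState

end DGScheme

namespace DGScheme

namespace DGState

open Triangulation

variable {d : ℕ} {Ω : Set (E d)} {T : Triangulation d Ω} {p : ℕ}

/-! ### Midpoint values and constants of the model -/

theorem InSpace.mid {S S' : DGState d} (h : S.InSpace T p) (h' : S'.InSpace T p) :
    (DGState.mid S S').InSpace T p where
  φ := (h.φ.add h'.φ).const_mul _
  v := h.v.mid h'.v
  lam := (h.lam.add h'.lam).const_mul _
  a := (h.a.add h'.a).const_mul _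
  b := (h.b.add h'.b).const_mul _
  q := h.q.mid h'.q

theorem _root_.DGScheme.Model.continuous_ρ (m : Model) : Continuous m.ρ := by
  unfold Model.ρ; fun_prop

theorem _root_.DGScheme.Model.cp_pos (m : Model) : 0 < m.cp := by
  have := m.ρ₁_pos; have := m.ρ₂_pos; unfold Model.cp; positivity

theorem _root_.DGScheme.Model.cm_mul (m : Model) : m.cm * (m.ρ₁ + m.ρ₂) = m.cp * (m.ρ₂ - m.ρ₁) := by
  have := m.ρ₁_pos; have := m.ρ₂_pos
  unfold Model.cm Model.cp; field_simp; ring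

/-! ### The energy identity -/

section Energy

variable {m : Model} {k : ℝ} {S S' : DGState d}

/-- The phase field equation, tested with `a`. -/
theorem Step.phase_test (h : S.InSpace T p) (h' : S'.InSpace T p) (hs : Step T m p k S S') :
    0 = k⁻¹ * T.integral (fun K x => (S'.φ K x - S.φ K x) * (mid S S').a K x)
      + T.integral (fun K x => (mid S S').a K x *
          dvg (fun K x => (mid S S').φ K x • (mid S S').v K x) K x)
      + m.cp * T.integral (fun K x => m.mr * (mid S S').a K x ^ 2)
      - m.cp * m.mj * T.A₁ m.σ (mid S S').a (mid S S').a
      - faceIntegral T.interiorFaces (fun F x =>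
          T.vjump (fun K x => (mid S S').φ K x • (mid S S').v K x) F x
            * T.avg (mid S S').a F x) := by
  have hM := h.mid h'
  have := hs.phase _ hM.a
  set M := DGState.mid S S'
  have hψ := (h'.φ.smooth.sub h.φ.smooth).cts
  have ha := hM.a.smooth.cts
  have hD := (hM.φ.smooth.smul hM.v.smooth).cts_dvg
  rw [this]
  congr 2
  rw [← integral_const_mul, ← integral_const_mul,
    ← integral_add ((hψ.mul ha).const_mul _) (ha.mul hD),
    ← integral_add (((hψ.mul ha).const_mul _).add (ha.mul hD))
      (Cts.const_mul (u := fun K x => m.mr * M.a K x ^ 2)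
        (fun K hK => continuous_const.mul ((ha K hK).pow 2)) _)]
  exact integral_congr fun K _ x => by ring

/-- The constraint, tested with `b`. -/
theorem Step.constraint_test (hd : 0 < d) (h : S.InSpace T p) (h' : S'.InSpace T p)
    (hs : Step T m p k S S') :
    0 = T.integral (fun K x => (mid S S').b K x * dvg (mid S S').v K x)
      - m.cm / m.cp * k⁻¹ * T.integral (fun K x => (S'.φ K x - S.φ K x) * (mid S S').b K x)
      - m.cm / m.cp * T.integral (fun K x => (mid S S').b K x *
          dvg (fun K x => (mid S S').φ K x • (mid S S').v K x) K x)
      + m.cm / m.cp * faceIntegral T.interiorFaces (fun F x =>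
          T.vjump (fun K x => (mid S S').φ K x • (mid S S').v K x) F x
            * T.avg (mid S S').b F x)
      - faceIntegral T.interiorFaces (fun F x =>
          T.vjump (mid S S').v F x * T.avg (mid S S').b F x) := by
  have hM := h.mid h'
  have := hs.constraint _ hM.b
  set M := DGState.mid S S'
  have hψ := (h'.φ.smooth.sub h.φ.smooth).cts
  have hb := hM.b.smooth.cts
  have hφv := hM.φ.smooth.smul hM.v.smooth
  rw [this, add_sub_assoc]
  congr 1
  · rw [← integral_const_mul, ← integral_const_mul,
      ← integral_sub (hb.mul hM.v.smooth.cts_dvg) ((hψ.mul hb).const_mul _),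
      ← integral_sub ((hb.mul hM.v.smooth.cts_dvg).sub ((hψ.mul hb).const_mul _))
        ((hb.mul hφv.cts_dvg).const_mul _)]
    exact integral_congr fun K _ x => by ring
  · rw [← faceIntegral_const_mul]
    refine Eq.symm (Eq.trans (Eq.symm (faceIntegral_sub hd
      (fun F => continuous_const.mul
        ((hφv.cts.continuous_vjump F).mul (hb.continuous_avg F)))
      (fun F => (hM.v.smooth.cts.continuous_vjump F).mul (hb.continuous_avg F)))) (Eq.symm ?_))
    exact faceIntegral_congr fun F _ x => by rw [vjump_smul_sub]; ring

/-- The equation of the chemical potential, tested with the increment of `φ`. -/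
theorem Step.potential_test (h : S.InSpace T p) (h' : S'.InSpace T p)
    (hs : Step T m p k S S') :
    0 = T.integral (fun K x => (S'.φ K x - S.φ K x) * (mid S S').a K x)
      - m.cp * (T.integral (fun K x => m.W (S'.φ K x)) - T.integral (fun K x => m.W (S.φ K x)))
      - m.cm * T.integral (fun K x => (S'.φ K x - S.φ K x) * (mid S S').lam K x)
      + m.cp * m.γ * T.integral (fun K x => (S'.φ K x - S.φ K x) * dvg (mid S S').q K x)
      - m.cp * m.γ * faceIntegral T.interiorFaces (fun F x =>
          T.vjump (mid S S').q F x * T.avg (fun K x => S'.φ K x - S.φ K x) F x) := by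
  have hM := h.mid h'
  have := hs.potential _ (h'.φ.sub h.φ)
  set M := DGState.mid S S'
  have hψ := (h'.φ.smooth.sub h.φ.smooth).cts
  have hW := Cts.comp m.contDiff_W.continuous h.φ.smooth.cts
  have hW' := Cts.comp m.contDiff_W.continuous h'.φ.smooth.cts
  have ha := hψ.mul hM.a.smooth.cts
  have hl := (hψ.mul hM.lam.smooth.cts).const_mul m.cm
  have hq := (hψ.mul hM.q.smooth.cts_dvg).const_mul (m.cp * m.γ)
  have hWW := (hW'.sub hW).const_mul m.cp
  rw [this]
  congr 1
  rw [← integral_sub hW' hW, ← integral_const_mul, ← integral_const_mul, ← integral_const_mul,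
    ← integral_sub ha hWW, ← integral_sub (ha.sub hWW) hl,
    ← integral_add ((ha.sub hWW).sub hl) hq]
  refine integral_congr fun K _ x => ?_
  -- This product formula also holds where `φ' = φ`, both sides being zero. Since it is applied
  -- pointwise before the integral is split, no regularity of the difference quotient is needed.
  have hslope := sub_smul_dslope m.W (S.φ K x) (S'.φ K x)
  rw [smul_eq_mul] at hslope
  rw [← hslope]
  ring

/-- The equation of the multiplier, tested with the increment of `φ`. -/
theorem Step.multiplier_test (h : S.InSpace T p) (h' : S'.InSpace T p)
    (hs : Step T m p k S S') :
    0 = T.integral (fun K x => (S'.φ K x - S.φ K x) * (mid S S').b K x)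
      - T.integral (fun K x => (S'.φ K x - S.φ K x) * (mid S S').lam K x)
      - (m.ρ₁ + m.ρ₂) / 8 * T.integral (fun K x =>
          (S'.φ K x - S.φ K x) * (‖S'.v K x‖ ^ 2 + ‖S.v K x‖ ^ 2)) := by
  have hM := h.mid h'
  have := hs.multiplier _ (h'.φ.sub h.φ)
  set M := DGState.mid S S'
  have hψ := (h'.φ.smooth.sub h.φ.smooth).cts
  have hv : T.Cts fun K x => ‖S'.v K x‖ ^ 2 + ‖S.v K x‖ ^ 2 := fun K hK =>
    ((h'.v.smooth.cts K hK).norm.pow 2).add ((h.v.smooth.cts K hK).norm.pow 2)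
  have hb := hψ.mul hM.b.smooth.cts
  have hl := hψ.mul hM.lam.smooth.cts
  rw [this, ← integral_const_mul, ← integral_sub hb hl,
    ← integral_sub (hb.sub hl) ((hψ.mul hv).const_mul _)]
  exact integral_congr fun K _ x => by ring

/-- The momentum equation, tested with `v`. -/
theorem Step.momentum_test (hd : 0 < d) (h : S.InSpace T p) (h' : S'.InSpace T p)
    (hs : Step T m p k S S') :
    0 = k⁻¹ * T.integral (fun K x => m.ρ ((mid S S').φ K x) *
          ⟪S'.v K x - S.v K x, (mid S S').v K x⟫)
      + T.integral (fun K x => ⟪grad (mid S S').b K x, (mid S S').v K x⟫)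
      + m.cp⁻¹ * T.integral (fun K x =>
          ⟪grad (fun K x => (mid S S').a K x - m.cm * (mid S S').b K x) K x,
            (mid S S').φ K x • (mid S S').v K x⟫)
      - m.η * T.A₂ m.σ (mid S S').v (mid S S').v
      - faceIntegral T.interiorFaces (fun F x =>
          ⟪T.jump (mid S S').b F x, T.avg (mid S S').v F x⟫)
      - m.cp⁻¹ * faceIntegral T.interiorFaces (fun F x =>
          ⟪T.jump (fun K x => (mid S S').a K x - m.cm * (mid S S').b K x) F x,
            T.avg (fun K x => (mid S S').φ K x • (mid S S').v K x) F x⟫) := by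
  have hM := h.mid h'
  have := hs.momentum _ hM.v
  set M := DGState.mid S S'
  have hv := hM.v.smooth
  have hb := hM.b.smooth
  have hg := hM.a.smooth.sub (hb.const_mul m.cm)
  have hφv := hM.φ.smooth.smul hv
  have h1 := ((Cts.comp m.continuous_ρ hM.φ.smooth.cts).mul
    ((h'.v.smooth.sub h.v.smooth).cts.inner hv.cts)).const_mul k⁻¹
  have h2 := hb.cts_grad.inner hv.cts
  have h3 := (hg.cts_grad.inner hφv.cts).const_mul m.cp⁻¹
  have hvol : T.integral (fun K x =>
      m.ρ (M.φ K x) * ⟪k⁻¹ • (S'.v K x - S.v K x), M.v K x⟫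
        + m.ρ (M.φ K x) * ⟪convect M.v K x, M.v K x⟫
        - 1 / 2 * m.ρ (M.φ K x) * ⟪grad (fun K x => ‖M.v K x‖ ^ 2) K x, M.v K x⟫
        + ⟪grad M.b K x, M.v K x⟫
        + M.φ K x / m.cp * ⟪grad (fun K x => M.a K x - m.cm * M.b K x) K x, M.v K x⟫) =
      k⁻¹ * T.integral (fun K x => m.ρ (M.φ K x) * ⟪S'.v K x - S.v K x, M.v K x⟫)
      + T.integral (fun K x => ⟪grad M.b K x, M.v K x⟫)
      + m.cp⁻¹ * T.integral (fun K x =>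
          ⟪grad (fun K x => M.a K x - m.cm * M.b K x) K x, M.φ K x • M.v K x⟫) := by
    rw [← integral_const_mul, ← integral_const_mul, ← integral_add h1 h2,
      ← integral_add (h1.add h2) h3]
    refine integral_congr fun K hK x => ?_
    -- The convective term and the term with `½∇|v|²` cancel pointwise, whatever the density.
    rw [inner_convect hv hK, inner_smul_left, inner_smul_right]
    simp only [conj_trivial]
    ring
  have hface : faceIntegral T.interiorFaces (fun F x =>
      - frob (outer (T.avg M.v F x) (T.avg (fun K x => m.ρ (M.φ K x) • M.v K x) F x))
          (T.tjump M.v F x)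
        + 1 / 2 * ⟪T.jump (fun K x => ‖M.v K x‖ ^ 2) F x,
            T.avg (fun K x => m.ρ (M.φ K x) • M.v K x) F x⟫
        - ⟪T.jump M.b F x, T.avg M.v F x⟫
        - 1 / m.cp * ⟪T.jump (fun K x => M.a K x - m.cm * M.b K x) F x,
            T.avg (fun K x => M.φ K x • M.v K x) F x⟫) =
      (-1) * faceIntegral T.interiorFaces (fun F x => ⟪T.jump M.b F x, T.avg M.v F x⟫)
      - m.cp⁻¹ * faceIntegral T.interiorFaces (fun F x =>
          ⟪T.jump (fun K x => M.a K x - m.cm * M.b K x) F x,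
            T.avg (fun K x => M.φ K x • M.v K x) F x⟫) := by
    rw [← faceIntegral_const_mul, ← faceIntegral_const_mul]
    refine Eq.symm (Eq.trans (Eq.symm (faceIntegral_sub hd
      (fun F => continuous_const.mul
        ((hb.cts.continuous_jump F).inner (hv.cts.continuous_avg F)))
      (fun F => continuous_const.mul
        ((hg.cts.continuous_jump F).inner (hφv.cts.continuous_avg F))))) (Eq.symm ?_))
    refine faceIntegral_congr fun F hF x => ?_
    rw [frob_convection hd _ _ hF]
    ring
  rw [hvol, hface] at this
  linarith

/-- The increment of the energy. -/
theorem energy_sub (h : S.InSpace T p) (h' : S'.InSpace T p) :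
    S'.energy T m - S.energy T m =
      (T.integral (fun K x => m.W (S'.φ K x)) - T.integral (fun K x => m.W (S.φ K x)))
      + T.integral (fun K x => m.ρ ((mid S S').φ K x) *
          ⟪S'.v K x - S.v K x, (mid S S').v K x⟫)
      + (m.ρ₁ - m.ρ₂) / 8 * T.integral (fun K x =>
          (S'.φ K x - S.φ K x) * (‖S'.v K x‖ ^ 2 + ‖S.v K x‖ ^ 2))
      + m.γ * T.integral (fun K x => ⟪S'.q K x - S.q K x, (mid S S').q K x⟫) := by
  have hM := h.mid h'
  have hψ := (h'.φ.smooth.sub h.φ.smooth).cts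
  have hW := Cts.comp m.contDiff_W.continuous h.φ.smooth.cts
  have hW' := Cts.comp m.contDiff_W.continuous h'.φ.smooth.cts
  have hv : T.Cts fun K x => ‖S'.v K x‖ ^ 2 + ‖S.v K x‖ ^ 2 := fun K hK =>
    ((h'.v.smooth.cts K hK).norm.pow 2).add ((h.v.smooth.cts K hK).norm.pow 2)
  have h1 := (Cts.comp m.continuous_ρ hM.φ.smooth.cts).mul
    ((h'.v.smooth.sub h.v.smooth).cts.inner hM.v.smooth.cts)
  have h2 := (hψ.mul hv).const_mul ((m.ρ₁ - m.ρ₂) / 8)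
  have h3 := ((h'.q.smooth.sub h.q.smooth).cts.inner hM.q.smooth.cts).const_mul m.γ
  have hE : ∀ {R : DGState d}, R.InSpace T p → T.Cts fun K x =>
      m.W (R.φ K x) + 1 / 2 * m.ρ (R.φ K x) * ‖R.v K x‖ ^ 2 + m.γ / 2 * ‖R.q K x‖ ^ 2 :=
    fun {R} hR K hK => by
      have c1 := hR.φ.smooth.cts K hK
      have c2 := hR.v.smooth.cts K hK
      have c3 := hR.q.smooth.cts K hK
      have c4 := m.contDiff_W.continuous
      have c5 := m.continuous_ρ
      fun_prop
  rw [energy, energy, ← integral_sub (hE h') (hE h), ← integral_sub hW' hW, ← integral_const_mul,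
    ← integral_const_mul, ← integral_add (hW'.sub hW) h1,
    ← integral_add ((hW'.sub hW).add h1) h2, ← integral_add (((hW'.sub hW).add h1).add h2) h3]
  refine integral_congr fun K _ x => ?_
  have hmid : ∀ y y' : E d, ⟪y' - y, (1 / 2 : ℝ) • (y + y')⟫ = 1 / 2 * (‖y'‖ ^ 2 - ‖y‖ ^ 2) := by
    intro y y'
    rw [inner_smul_right, inner_add_right, inner_sub_left, inner_sub_left,
      real_inner_self_eq_norm_sq, real_inner_self_eq_norm_sq, real_inner_comm y y']
    ring
  -- Discrete product rule for `½ρ|v|²`: midpoint density times the increment of `½|v|²`, plus the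
  -- increment of `ρ` times the mean of `½|v|²`. As `ρ` is affine with slope `(ρ₁ - ρ₂)/2`, the
  -- second part has the factor `(ρ₁ - ρ₂)/8`.
  simp only [mid, hmid, Model.ρ]
  ring

/-- The linear combination of the tested equations that yields the energy identity. -/
theorem energy_balance {k s cp cm ρ₁ ρ₂ γ mj η A₁ A₂ Ψa Da R W₁ W₀ Jφa V B G JB JG Bv Ψb Db Jφb Jv
    Ψl Ψq Jq Ψv Q Ψg Jg E₁ E₀ : ℝ} (hk : k ≠ 0) (hs : s * cp = 1)
    (hρ : ρ₁ - ρ₂ = -(cm * s * (ρ₁ + ρ₂)))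
    (eP : 0 = k⁻¹ * Ψa + Da + cp * R - cp * mj * A₁ - Jφa)
    (eM : 0 = k⁻¹ * V + B + s * G - η * A₂ - JB - s * JG)
    (eC : 0 = Bv - cm * s * k⁻¹ * Ψb - cm * s * Db + cm * s * Jφb - Jv)
    (eQ : 0 = Ψa - cp * (W₁ - W₀) - cm * Ψl + cp * γ * Ψq - cp * γ * Jq)
    (eL : 0 = Ψb - Ψl - (ρ₁ + ρ₂) / 8 * Ψv)
    (eG : Q - Ψg + Jg = 0)
    (i1 : G + (Da - cm * Db) = JG + (Jφa - cm * Jφb))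
    (i2 : B + Bv = JB + Jv)
    (i3 : Ψg + Ψq = Jg + Jq)
    (eE : E₁ - E₀ = (W₁ - W₀) + V + (ρ₁ - ρ₂) / 8 * Ψv + γ * Q) :
    E₁ = E₀ - k * (R - mj * A₁ - η * A₂) := by
  -- Phase, momentum and constraint equations; `i1` and `i2` remove all transport and pressure
  -- terms.
  have hdiss : k⁻¹ * (s * Ψa + V - cm * s * Ψb) = -(R - mj * A₁ - η * A₂) := by
    linear_combination (-s) * eP - eM - eC - s * i1 - i2 - (R - mj * A₁) * hs
  -- Potential, multiplier and gradient equations; `hρ` removes the kinetic correction `Ψv`, while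
  -- `eG` and `i3` remove the capillary terms.
  have hincr : E₁ - E₀ = s * Ψa + V - cm * s * Ψb := by
    linear_combination eE + s * eQ + (-(W₁ - W₀) + γ * Ψq - γ * Jq) * hs - cm * s * eL
      + γ * eG + γ * i3 + Ψv / 8 * hρ
  have hk' : k * k⁻¹ = 1 := mul_inv_cancel₀ hk
  linear_combination hincr + k * hdiss - (s * Ψa + V - cm * s * Ψb) * hk'

/-- The energy identity for one step of the scheme. -/
theorem Step.energy_eq (hd : 0 < d) (hk : k ≠ 0) (h : S.InSpace T p) (h' : S'.InSpace T p)
    (hgrad : IsDiscreteGradient T p S.φ S.q) (hs : Step T m p k S S') :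
    S'.energy T m = S.energy T m
      - k * (T.integral (fun K x => m.mr * (mid S S').a K x ^ 2)
          - m.mj * T.A₁ m.σ (mid S S').a (mid S S').a
          - m.η * T.A₂ m.σ (mid S S').v (mid S S').v) := by
  have hM := h.mid h'
  have hgrad' := hgrad.next hd h.φ.smooth h'.φ.smooth h.q.smooth h'.q.smooth hs.gradient
  have hψ := h'.φ.smooth.sub h.φ.smooth
  have eG := isDiscreteGradient_iff hψ (h'.q.smooth.sub h.q.smooth) |>.1
    (hgrad.sub hd h.φ.smooth h'.φ.smooth h.q.smooth h'.q.smooth hgrad') _ hM.q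
  have eP := hs.phase_test h h'
  have eC := hs.constraint_test hd h h'
  have eQ := hs.potential_test h h'
  have eL := hs.multiplier_test h h'
  have eM := hs.momentum_test hd h h'
  have eE := energy_sub (m := m) h h'
  have hφv := hM.φ.smooth.smul hM.v.smooth
  have hg := hM.a.smooth.sub (hM.b.smooth.const_mul m.cm)
  have i1 := integral_by_parts hd hg hφv fun F hF K hK x hx => by
    simp [hM.v.eq_zero hF hK hx]
  have i2 := integral_by_parts hd hM.b.smooth hM.v.smooth fun F hF K hK x hx => by
    simp [hM.v.eq_zero hF hK hx]
  have i3 := integral_by_parts hd hψ hM.q.smooth fun F hF K hK x hx => by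
    rw [hM.q.2 F hF K hK x hx, mul_zero]
  set M := DGState.mid S S'
  have ha := hM.a.smooth.cts
  have hb := hM.b.smooth.cts
  have s1 : T.integral (fun K x => (M.a K x - m.cm * M.b K x) *
        dvg (fun K x => M.φ K x • M.v K x) K x) =
      T.integral (fun K x => M.a K x * dvg (fun K x => M.φ K x • M.v K x) K x) -
        m.cm * T.integral (fun K x => M.b K x * dvg (fun K x => M.φ K x • M.v K x) K x) := by
    rw [← integral_const_mul,
      ← integral_sub (ha.mul hφv.cts_dvg) ((hb.mul hφv.cts_dvg).const_mul _)]
    exact integral_congr fun K _ x => by ring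
  have s2 : faceIntegral T.interiorFaces (fun F x =>
        T.vjump (fun K x => M.φ K x • M.v K x) F x *
          T.avg (fun K x => M.a K x - m.cm * M.b K x) F x) =
      faceIntegral T.interiorFaces (fun F x =>
        T.vjump (fun K x => M.φ K x • M.v K x) F x * T.avg M.a F x) -
      m.cm * faceIntegral T.interiorFaces (fun F x =>
        T.vjump (fun K x => M.φ K x • M.v K x) F x * T.avg M.b F x) := by
    rw [← faceIntegral_const_mul]
    refine Eq.symm (Eq.trans (Eq.symm (faceIntegral_sub hd
      (fun F => (hφv.cts.continuous_vjump F).mul (ha.continuous_avg F))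
      (fun F => continuous_const.mul
        ((hφv.cts.continuous_vjump F).mul (hb.continuous_avg F))))) (Eq.symm ?_))
    exact faceIntegral_congr fun F _ x => by rw [avg_sub_const_mul]; ring
  rw [s1, s2] at i1
  have hs' : m.cp⁻¹ * m.cp = 1 := inv_mul_cancel₀ m.cp_pos.ne'
  have hρ : m.ρ₁ - m.ρ₂ = -(m.cm * m.cp⁻¹ * (m.ρ₁ + m.ρ₂)) := by
    linear_combination m.cp⁻¹ * m.cm_mul + (m.ρ₂ - m.ρ₁) * hs'
  rw [div_eq_mul_inv] at eC
  exact energy_balance hk hs' hρ eP eM eC eQ eL eG i1 i2 i3 eE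

end Energy

end DGState

end DGScheme

/-! ### Induction over the time levels and conclusion -/

theorem DGScheme.DGState.isDiscreteGradient_of_steps {d : ℕ} (hd : 0 < d) {Ω : Set (DGScheme.E d)}
    {T : DGScheme.Triangulation d Ω} {m : DGScheme.Model} {p N : ℕ} {k : ℕ → ℝ}
    {S : ℕ → DGScheme.DGState d} (hS : ∀ n ≤ N, (S n).InSpace T p)
    (hinit : DGScheme.DGState.IsDiscreteGradient T p (S 0).φ (S 0).q)
    (hstep : ∀ n < N, DGScheme.DGState.Step T m p (k n) (S n) (S (n + 1))) :
    ∀ n ≤ N, DGScheme.DGState.IsDiscreteGradient T p (S n).φ (S n).q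
  | 0, _ => hinit
  | n + 1, hn =>
    (isDiscreteGradient_of_steps hd hS hinit hstep n (by omega)).next hd
      (hS n (by omega)).φ.smooth (hS (n + 1) hn).φ.smooth
      (hS n (by omega)).q.smooth (hS (n + 1) hn).q.smooth (hstep n hn).gradient

theorem mainTheorem1 {d : ℕ} (hd : 0 < d) {Ω : Set (DGScheme.E d)}
    (hΩ : interior (closure Ω) = Ω)
    (T : DGScheme.Triangulation d Ω) (m : DGScheme.Model) (p : ℕ)
    (N : ℕ) (t : ℕ → ℝ) (ht : ∀ n < N, t n < t (n + 1))
    (S : ℕ → DGScheme.DGState d)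
    (hS : ∀ n ≤ N, (S n).InSpace T p)
    (hinit : DGScheme.DGState.IsDiscreteGradient T p (S 0).φ (S 0).q)
    (hstep : ∀ n < N, DGScheme.DGState.Step T m p (t (n + 1) - t n) (S n) (S (n + 1))) :
    ∀ n < N,
      (S (n + 1)).energy T m =
        (S n).energy T m
        - (t (n + 1) - t n) *
          (T.integral (fun K x => m.mr * ((S n).mid (S (n + 1))).a K x ^ 2)
            - m.mj * T.A₁ m.σ ((S n).mid (S (n + 1))).a ((S n).mid (S (n + 1))).a
            - m.η * T.A₂ m.σ ((S n).mid (S (n + 1))).v ((S n).mid (S (n + 1))).v) := by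
  intro n hn
  exact (hstep n hn).energy_eq hd (sub_ne_zero.2 (ht n hn).ne') (hS n hn.le) (hS (n + 1) hn)
    (DGScheme.DGState.isDiscreteGradient_of_steps hd hS hinit hstep n hn.le)
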